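/- Let $m\ge 2$, let $PL(m)=GL(m,\mathbb{R})/\mathbb{R}^{*}I$, a Lie group with Lie algebra $\mathfrak{sl}(m)$, and let $\nabla_m$ be the left invariant linear connection on $PL(m)$ such that $$(\nabla_m)_Y Z = YZ-\tfrac{1}{m}\operatorname{tr}(YZ)\,I\qquad (Y,Z\in\mathfrak{sl}(m)),$$ where elements of $\mathfrak{sl}(m)$ are regarded as left invariant vector fields. Two smooth linear connections $\nabla,\nabla'$ on a manifold are called projectively equivalent if there is a smooth $1$-form $p$ with $\nabla'_XY=\nabla_XY+p(X)Y+p(Y)X$ for all vector fields $X,Y$; a linear connection is called affinely flat if its torsion and its curvature vanish, and projectively flat if near every point it is carried by a local diffeomorphism to a connection projectively equivalent to the standard flat connection of $\mathbb{R}^N$. The Ricci tensor is $\operatorname{Ric}(Y,Z)=\operatorname{tr}(X\mapsto R(X,Y)Z)$. Let $\nabla'$ be any smooth linear connection on $PL(m)$, not necessarily left invariant, which is projectively equivalent to $\nabla_m$. Then: 1. $\nabla'$ is not affinely flat. 2. The Ricci tensor of $\nabla'$ is not identically zero. 3. For every nonempty manifold $M$ (Hausdorff, second countable, smooth) of dimension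 at least $1$ and every affinely flat smooth linear connection $\nabla$ on $M$, the product connection $\nabla\times\nabla'$ on $M\times PL(m)$ is not projectively flat. -/

import Mathlib

open Bundle
open scoped Manifold ContDiff MatrixGroups Matrix.Norms.Elementwise

noncomputable section

/-- The projective linear group `PL(m) = GL(m, ℝ) / ℝˣ`. -/
abbrev PL (m : ℕ) : Type := Matrix.ProjGenLinGroup (Fin m) ℝ

/-- The space `𝔰𝔩(m)` of real trace-free `m × m` matrices. -/
def SLAlg (m : ℕ) : Type := LinearMap.ker (Matrix.traceLinearMap (Fin m) ℝ ℝ)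

namespace SLAlg

instance (m : ℕ) : NormedAddCommGroup (SLAlg m) :=
  inferInstanceAs (NormedAddCommGroup (LinearMap.ker (Matrix.traceLinearMap (Fin m) ℝ ℝ)))

instance (m : ℕ) : NormedSpace ℝ (SLAlg m) :=
  inferInstanceAs (NormedSpace ℝ (LinearMap.ker (Matrix.traceLinearMap (Fin m) ℝ ℝ)))

instance (m : ℕ) : FiniteDimensional ℝ (SLAlg m) :=
  inferInstanceAs (FiniteDimensional ℝ (LinearMap.ker (Matrix.traceLinearMap (Fin m) ℝ ℝ)))

/-- The underlying matrix of an element of `𝔰𝔩(m)`. -/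
def mat {m : ℕ} : SLAlg m →ₗ[ℝ] Matrix (Fin m) (Fin m) ℝ :=
  (LinearMap.ker (Matrix.traceLinearMap (Fin m) ℝ ℝ)).subtype

theorem trace_mat {m : ℕ} (X : SLAlg m) : (mat X).trace = 0 := X.2

theorem mat_injective {m : ℕ} : Function.Injective (mat : SLAlg m → _) :=
  Subtype.val_injective

theorem contDiff_mat {m : ℕ} : ContDiff ℝ ∞ (mat : SLAlg m → _) :=
  (LinearMap.toContinuousLinearMap (mat (m := m))).contDiff

theorem continuous_mat {m : ℕ} : Continuous (mat : SLAlg m → _) :=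
  contDiff_mat.continuous

end SLAlg

open SLAlg (mat)

/-- The trace-free part `A ↦ A - (tr A / m) I` of a square matrix. -/
def slPart (m : ℕ) [NeZero m] : Matrix (Fin m) (Fin m) ℝ →ₗ[ℝ] SLAlg m :=
  LinearMap.codRestrict (LinearMap.ker (Matrix.traceLinearMap (Fin m) ℝ ℝ))
    (LinearMap.id - ((m : ℝ)⁻¹ • Matrix.traceLinearMap (Fin m) ℝ ℝ).smulRight 1) (fun A ↦ by
      simp [Matrix.trace_sub, Matrix.trace_smul, NeZero.ne, mul_comm])

theorem mat_slPart (m : ℕ) [NeZero m] (A : Matrix (Fin m) (Fin m) ℝ) :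
    mat (slPart m A) = A - (A.trace / m) • (1 : Matrix (Fin m) (Fin m) ℝ) := by
  rw [div_eq_inv_mul]
  rfl

namespace PL

variable {m : ℕ}

/-- The quotient topology. -/
instance : TopologicalSpace (PL m) :=
  inferInstanceAs (TopologicalSpace (GL (Fin m) ℝ ⧸ Subgroup.center (GL (Fin m) ℝ)))

instance : IsTopologicalGroup (PL m) :=
  inferInstanceAs (IsTopologicalGroup (GL (Fin m) ℝ ⧸ Subgroup.center (GL (Fin m) ℝ)))

theorem isOpenQuotientMap_mk :
    IsOpenQuotientMap (Matrix.ProjGenLinGroup.mk : GL (Fin m) ℝ → PL m) :=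
  QuotientGroup.isOpenQuotientMap_mk

/-- The class in `PL(m)` of a matrix, with value `1` at singular matrices. -/
def ofMatrix (A : Matrix (Fin m) (Fin m) ℝ) : PL m :=
  if h : A.det ≠ 0 then
    Matrix.ProjGenLinGroup.mk (Matrix.GeneralLinearGroup.mkOfDetNeZero A h) else 1

theorem ofMatrix_coe (g : GL (Fin m) ℝ) :
    ofMatrix (g : Matrix (Fin m) (Fin m) ℝ) = Matrix.ProjGenLinGroup.mk g := by
  have h : (g : Matrix (Fin m) (Fin m) ℝ).det ≠ 0 := g.det_ne_zero
  rw [ofMatrix, dif_pos h]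
  congr 1
  ext1
  rfl

theorem ofMatrix_smul (c : ℝ) (hc : c ≠ 0) (A : Matrix (Fin m) (Fin m) ℝ) (hA : A.det ≠ 0) :
    ofMatrix (c • A) = ofMatrix A := by
  have h : (c • A).det ≠ 0 := by
    rw [Matrix.det_smul]; exact mul_ne_zero (pow_ne_zero _ hc) hA
  rw [ofMatrix, ofMatrix, dif_pos hA, dif_pos h, eq_comm, Matrix.ProjGenLinGroup.mk_eq_mk_iff]
  refine ⟨Units.mk0 c hc, ?_⟩
  ext1
  simp [Matrix.GeneralLinearGroup.coe_scalar, Matrix.GeneralLinearGroup.mkOfDetNeZero,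
    ← Matrix.smul_one_eq_diagonal]

theorem exists_ofMatrix (p : PL m) :
    ∃ A : Matrix (Fin m) (Fin m) ℝ, A.det ≠ 0 ∧ ofMatrix A = p := by
  obtain ⟨g, rfl⟩ := Matrix.ProjGenLinGroup.mk_surjective p
  exact ⟨g, g.det_ne_zero, ofMatrix_coe g⟩

theorem ofMatrix_mul {A B : Matrix (Fin m) (Fin m) ℝ} (hA : A.det ≠ 0) (hB : B.det ≠ 0) :
    ofMatrix (A * B) = ofMatrix A * ofMatrix B := by
  have h := ofMatrix_coe (Matrix.GeneralLinearGroup.mkOfDetNeZero A hA *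
    Matrix.GeneralLinearGroup.mkOfDetNeZero B hB)
  rw [map_mul, ← ofMatrix_coe, ← ofMatrix_coe] at h
  exact h

theorem ofMatrix_one : ofMatrix (1 : Matrix (Fin m) (Fin m) ℝ) = 1 := by
  have h := ofMatrix_coe (1 : GL (Fin m) ℝ)
  rwa [map_one] at h

theorem continuousOn_ofMatrix :
    ContinuousOn (ofMatrix : Matrix (Fin m) (Fin m) ℝ → PL m) {A | A.det ≠ 0} := by
  rw [continuousOn_iff_continuous_domRestrict]
  have : Set.domRestrict {A : Matrix (Fin m) (Fin m) ℝ | A.det ≠ 0} ofMatrix =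
      fun A ↦ Matrix.ProjGenLinGroup.mk (Matrix.GeneralLinearGroup.mkOfDetNeZero A.1 A.2) := by
    funext A
    have hA : A.1.det ≠ 0 := A.2
    simp only [Set.domRestrict_apply, ofMatrix]
    rw [dif_pos hA]
  rw [this]
  refine isOpenQuotientMap_mk.continuous.comp (Units.continuous_iff.2 ⟨?_, ?_⟩)
  · exact continuous_subtype_val
  · have h : (fun A : {A : Matrix (Fin m) (Fin m) ℝ | A.det ≠ 0} ↦ A.1.det⁻¹ • A.1.adjugate) =
        fun A ↦ ((Matrix.GeneralLinearGroup.mkOfDetNeZero A.1 A.2)⁻¹ :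
          GL (Fin m) ℝ).1 := by
      funext A
      rw [Matrix.coe_units_inv, Matrix.inv_def, Ring.inverse_eq_inv']
      rfl
    change Continuous fun A : {A : Matrix (Fin m) (Fin m) ℝ | A.det ≠ 0} ↦
      ((Matrix.GeneralLinearGroup.mkOfDetNeZero A.1 A.2)⁻¹ : GL (Fin m) ℝ).1
    rw [← h]
    exact (continuous_subtype_val.matrix_det.inv₀ fun A ↦ A.2).smul
      continuous_subtype_val.matrix_adjugate

theorem contDiff_matrix_mul {F : Type*} [NormedAddCommGroup F] [NormedSpace ℝ F]
    {f g : F → Matrix (Fin m) (Fin m) ℝ} (hf : ContDiff ℝ ∞ f) (hg : ContDiff ℝ ∞ g) :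
    ContDiff ℝ ∞ fun x ↦ f x * g x := by
  refine contDiff_pi.2 fun i ↦ contDiff_pi.2 fun j ↦ ?_
  have hf' := fun i j ↦ contDiff_pi.1 (contDiff_pi.1 hf i) j
  have hg' := fun i j ↦ contDiff_pi.1 (contDiff_pi.1 hg i) j
  simp only [Matrix.mul_apply]
  exact ContDiff.sum fun k _ ↦ (hf' i k).mul (hg' k j)

theorem contDiff_trace : ContDiff ℝ ∞ (Matrix.trace : Matrix (Fin m) (Fin m) ℝ → ℝ) :=
  (LinearMap.toContinuousLinearMap (Matrix.traceLinearMap (Fin m) ℝ ℝ)).contDiff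

theorem contDiff_one_add :
    ContDiff ℝ ∞ fun X : SLAlg m ↦ 1 + mat X :=
  contDiff_const.add SLAlg.contDiff_mat

theorem contDiff_adjugate {F : Type*} [NormedAddCommGroup F] [NormedSpace ℝ F]
    {f : F → Matrix (Fin m) (Fin m) ℝ} (hf : ContDiff ℝ ∞ f) :
    ContDiff ℝ ∞ fun x ↦ (f x).adjugate := by
  have hf' := fun i j ↦ contDiff_pi.1 (contDiff_pi.1 hf i) j
  refine contDiff_pi.2 fun i ↦ contDiff_pi.2 fun j ↦ ?_
  simp only [Matrix.adjugate_apply, Matrix.det_apply]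
  refine ContDiff.sum fun σ _ ↦ ContDiff.const_smul _ (contDiff_prod fun k _ ↦ ?_)
  simp only [Matrix.updateRow_apply]
  split_ifs
  · exact contDiff_const
  · exact hf' _ _

variable [NeZero m]

/-- The affine coordinate `[A] ↦ (m / tr A) A - I` on `PL(m)` near the identity. -/
def coordOne (p : PL m) : SLAlg m :=
  Quotient.liftOn' p
    (fun g : GL (Fin m) ℝ ↦
      slPart m (((m : ℝ) / (g : Matrix (Fin m) (Fin m) ℝ).trace) • (g : Matrix (Fin m) (Fin m) ℝ)))
    (by
      intro g h hgh
      have h1 : Matrix.ProjGenLinGroup.mk g = Matrix.ProjGenLinGroup.mk h := Quotient.sound' hgh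
      obtain ⟨u, rfl⟩ := Matrix.ProjGenLinGroup.mk_eq_mk_iff.1 h1
      have h2 : ((g * Matrix.GeneralLinearGroup.scalar (Fin m) u : GL (Fin m) ℝ) :
          Matrix (Fin m) (Fin m) ℝ) = (u : ℝ) • (g : Matrix (Fin m) (Fin m) ℝ) := by
        simp [Matrix.GeneralLinearGroup.coe_scalar, ← Matrix.smul_one_eq_diagonal]
      rw [h2, Matrix.trace_smul, smul_smul, smul_eq_mul]
      congr 2
      have hu : (u : ℝ) ≠ 0 := u.ne_zero
      by_cases ht : (g : Matrix (Fin m) (Fin m) ℝ).trace = 0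
      · simp [ht]
      · field_simp)

theorem coordOne_ofMatrix {A : Matrix (Fin m) (Fin m) ℝ} (hA : A.det ≠ 0) :
    coordOne (ofMatrix A) = slPart m (((m : ℝ) / A.trace) • A) := by
  have h := ofMatrix_coe (Matrix.GeneralLinearGroup.mkOfDetNeZero A hA)
  change ofMatrix A = _ at h
  rw [h]
  rfl

theorem continuous_slPart : Continuous (slPart m) :=
  (slPart m).continuous_of_finiteDimensional

/-- The domain of the affine coordinate: classes of matrices of nonzero trace. -/
def coordSource (m : ℕ) [NeZero m] : Set (PL m) :=
  {p | ∀ A : Matrix (Fin m) (Fin m) ℝ, A.det ≠ 0 → ofMatrix A = p → A.trace ≠ 0}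

theorem ofMatrix_mem_coordSource {A : Matrix (Fin m) (Fin m) ℝ} (hA : A.det ≠ 0) :
    ofMatrix A ∈ coordSource m ↔ A.trace ≠ 0 := by
  refine ⟨fun h ↦ h A hA rfl, fun h B hB hBA ↦ ?_⟩
  rw [ofMatrix, ofMatrix, dif_pos hA, dif_pos hB, eq_comm,
    Matrix.ProjGenLinGroup.mk_eq_mk_iff] at hBA
  obtain ⟨u, hu⟩ := hBA
  have h2 : B = (u : ℝ) • A := by
    have h3 := congrArg (fun g : GL (Fin m) ℝ ↦ (g : Matrix (Fin m) (Fin m) ℝ)) hu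
    simp [Matrix.GeneralLinearGroup.coe_scalar, ← Matrix.smul_one_eq_diagonal,
      Matrix.GeneralLinearGroup.mkOfDetNeZero] at h3
    exact h3.symm
  rw [h2, Matrix.trace_smul]
  exact smul_ne_zero u.ne_zero h

theorem one_add_coordOne {A : Matrix (Fin m) (Fin m) ℝ} (hA : A.det ≠ 0) (ht : A.trace ≠ 0) :
    1 + mat (coordOne (ofMatrix A)) = ((m : ℝ) / A.trace) • A := by
  have hm : (m : ℝ) ≠ 0 := NeZero.ne _
  rw [coordOne_ofMatrix hA]
  rw [mat_slPart, Matrix.trace_smul, smul_eq_mul]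
  rw [div_mul_cancel₀ _ ht, div_self hm, one_smul, add_sub_cancel]

/-- The affine chart of `PL(m)` at the identity. -/
def chartOne (m : ℕ) [NeZero m] : OpenPartialHomeomorph (PL m) (SLAlg m) where
  toFun := coordOne
  invFun X := ofMatrix (1 + mat X)
  source := coordSource m
  target := {X | (1 + mat X).det ≠ 0}
  map_source' p hp := by
    obtain ⟨A, hA, rfl⟩ := exists_ofMatrix p
    have ht := (ofMatrix_mem_coordSource hA).1 hp
    have hm : (m : ℝ) ≠ 0 := NeZero.ne _
    rw [Set.mem_ofPred_eq, one_add_coordOne hA ht, Matrix.det_smul]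
    exact mul_ne_zero (pow_ne_zero _ (div_ne_zero hm ht)) hA
  map_target' X hX := by
    have hX0 : (mat X).trace = 0 := SLAlg.trace_mat X
    rw [ofMatrix_mem_coordSource hX, Matrix.trace_add, hX0]
    simp [NeZero.ne]
  left_inv' p hp := by
    obtain ⟨A, hA, rfl⟩ := exists_ofMatrix p
    have ht := (ofMatrix_mem_coordSource hA).1 hp
    have hm : (m : ℝ) ≠ 0 := NeZero.ne _
    rw [one_add_coordOne hA ht, ofMatrix_smul _ (div_ne_zero hm ht) _ hA]
  right_inv' X hX := by
    have hX0 : (mat X).trace = 0 := SLAlg.trace_mat X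
    have hm : (m : ℝ) ≠ 0 := NeZero.ne _
    have ht : (1 + mat X).trace ≠ 0 := by
      rw [Matrix.trace_add, hX0]; simp [NeZero.ne]
    have h := one_add_coordOne hX ht
    rw [Matrix.trace_add, hX0, Matrix.trace_one, Fintype.card_fin, add_zero, div_self hm,
      one_smul] at h
    exact SLAlg.mat_injective (add_left_cancel h)
  open_source := by
    rw [← isOpenQuotientMap_mk.isQuotientMap.isOpen_preimage]
    have : (Matrix.ProjGenLinGroup.mk : GL (Fin m) ℝ → PL m) ⁻¹' coordSource m =
        {g : GL (Fin m) ℝ | (g : Matrix (Fin m) (Fin m) ℝ).trace ≠ 0} := by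
      ext g
      rw [Set.mem_preimage, ← ofMatrix_coe, ofMatrix_mem_coordSource g.det_ne_zero]
      rfl
    rw [this]
    exact isOpen_ne_fun Units.continuous_val.matrix_trace continuous_const
  open_target :=
    isOpen_ne_fun ((continuous_const.add SLAlg.continuous_mat).matrix_det) continuous_const
  continuousOn_toFun p hp := by
    obtain ⟨A, hA, rfl⟩ := exists_ofMatrix p
    have ht := (ofMatrix_mem_coordSource hA).1 hp
    refine ContinuousAt.continuousWithinAt ?_
    have hAg := ofMatrix_coe (Matrix.GeneralLinearGroup.mkOfDetNeZero A hA)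
    change ofMatrix A = _ at hAg
    rw [hAg, ← isOpenQuotientMap_mk.continuousAt_comp_iff]
    change ContinuousAt (fun g : GL (Fin m) ℝ ↦ slPart m
      (((m : ℝ) / (g : Matrix (Fin m) (Fin m) ℝ).trace) • (g : Matrix (Fin m) (Fin m) ℝ))) _
    have h1 : ContinuousAt (fun g : GL (Fin m) ℝ ↦ (g : Matrix (Fin m) (Fin m) ℝ).trace)
        (Matrix.GeneralLinearGroup.mkOfDetNeZero A hA) :=
      Units.continuous_val.matrix_trace.continuousAt
    have h2 : ContinuousAt (fun g : GL (Fin m) ℝ ↦ (g : Matrix (Fin m) (Fin m) ℝ))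
        (Matrix.GeneralLinearGroup.mkOfDetNeZero A hA) := Units.continuous_val.continuousAt
    have h3 : ContinuousAt (fun g : GL (Fin m) ℝ ↦
        ((m : ℝ) / (g : Matrix (Fin m) (Fin m) ℝ).trace) • (g : Matrix (Fin m) (Fin m) ℝ))
        (Matrix.GeneralLinearGroup.mkOfDetNeZero A hA) :=
      (continuousAt_const.div h1 ht).smul h2
    exact continuous_slPart.continuousAt.comp h3
  continuousOn_invFun := by
    refine continuousOn_ofMatrix.comp ?_ fun X hX ↦ hX
    exact (continuous_const.add SLAlg.continuous_mat).continuousOn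

/-- The chart at `p`, obtained from the affine chart at the identity by left translation. -/
def chart (p : PL m) : OpenPartialHomeomorph (PL m) (SLAlg m) :=
  (Homeomorph.mulLeft p⁻¹).transOpenPartialHomeomorph (chartOne m)

theorem one_mem_coordSource : (1 : PL m) ∈ coordSource m := by
  rw [← ofMatrix_one, ofMatrix_mem_coordSource (by simp)]
  simp [NeZero.ne]

instance : ChartedSpace (SLAlg m) (PL m) where
  atlas := Set.range chart
  chartAt := chart
  mem_chart_source p := by
    change p⁻¹ * p ∈ coordSource m
    rw [inv_mul_cancel]
    exact one_mem_coordSource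
  chart_mem_atlas p := Set.mem_range_self p

theorem contDiff_slPart : ContDiff ℝ ∞ (slPart m) :=
  (LinearMap.toContinuousLinearMap (slPart m)).contDiff

/-- The affine coordinate, as a function of matrices, is smooth. -/
theorem contDiffOn_coordOne_ofMatrix :
    ContDiffOn ℝ ∞ (fun A : Matrix (Fin m) (Fin m) ℝ ↦ coordOne (ofMatrix A))
      {A | A.det ≠ 0 ∧ A.trace ≠ 0} := by
  have : ContDiffOn ℝ ∞ (fun A : Matrix (Fin m) (Fin m) ℝ ↦
      slPart m (((m : ℝ) / A.trace) • A)) {A | A.det ≠ 0 ∧ A.trace ≠ 0} :=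
    contDiff_slPart.comp_contDiffOn ((contDiffOn_const.div contDiff_trace.contDiffOn
      fun A hA ↦ hA.2).smul contDiffOn_id)
  exact this.congr fun A hA ↦ coordOne_ofMatrix hA.1

instance : IsManifold 𝓘(ℝ, SLAlg m) ∞ (PL m) := by
  apply isManifold_of_contDiffOn
  rintro _ _ ⟨p, rfl⟩ ⟨q, rfl⟩
  obtain ⟨C, hC, hCpq⟩ := exists_ofMatrix (q⁻¹ * p)
  have hfun : ∀ X : SLAlg m, X ∈ (chartOne m).target →
      q⁻¹ * ((Homeomorph.mulLeft p⁻¹).symm (ofMatrix (1 + mat X))) =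
        ofMatrix (C * (1 + mat X)) := by
    intro X hX
    rw [ofMatrix_mul hC hX, hCpq, mul_assoc]
    change q⁻¹ * (p⁻¹⁻¹ * ofMatrix (1 + mat X)) = _
    rw [inv_inv]
  have hsm : ContDiff ℝ ∞ fun X : SLAlg m ↦ C * (1 + mat X) :=
    contDiff_matrix_mul contDiff_const contDiff_one_add
  have hmem : ∀ X : SLAlg m, X ∈ ((chart p).symm ≫ₕ chart q).source →
      X ∈ (chartOne m).target ∧ (C * (1 + mat X)).det ≠ 0 ∧
        (C * (1 + mat X)).trace ≠ 0 := by
    intro X hX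
    have h1 : X ∈ (chartOne m).target := hX.1
    have h2 : q⁻¹ * ((Homeomorph.mulLeft p⁻¹).symm
      (ofMatrix (1 + mat X))) ∈ coordSource m := hX.2
    rw [hfun X h1] at h2
    have h3 : (C * (1 + mat X)).det ≠ 0 := by
      rw [Matrix.det_mul]; exact mul_ne_zero hC h1
    exact ⟨h1, h3, (ofMatrix_mem_coordSource h3).1 h2⟩
  have hmain : ContDiffOn ℝ ∞
      (fun X : SLAlg m ↦ coordOne (ofMatrix (C * (1 + mat X))))
      ((chart p).symm ≫ₕ chart q).source :=
    contDiffOn_coordOne_ofMatrix.comp hsm.contDiffOn fun X hX ↦ (hmem X hX).2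
  simp only [modelWithCornersSelf_coe, modelWithCornersSelf_coe_symm, Function.id_comp,
    Function.comp_id, Set.preimage_id, Set.range_id, Set.inter_univ]
  refine hmain.congr fun X hX ↦ ?_
  rw [← hfun X (hmem X hX).1]
  rfl

theorem chart_apply (p q : PL m) : chart p q = coordOne (p⁻¹ * q) := rfl

theorem chart_symm_apply (p : PL m) (X : SLAlg m) :
    (chart p).symm X = p * ofMatrix (1 + mat X) := by
  change p⁻¹⁻¹ * ofMatrix (1 + mat X) = _
  rw [inv_inv]

theorem chart_mem_maximalAtlas (p : PL m) :
    chart p ∈ IsManifold.maximalAtlas 𝓘(ℝ, SLAlg m) ∞ (PL m) :=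
  IsManifold.subset_maximalAtlas ⟨p, rfl⟩

theorem mem_chart_source_self (p : PL m) : p ∈ (chart p).source := mem_chart_source (SLAlg m) p

theorem contMDiffAt_chart (p : PL m) :
    ContMDiffAt 𝓘(ℝ, SLAlg m) 𝓘(ℝ, SLAlg m) ∞ (chart p) p :=
  contMDiffAt_of_mem_maximalAtlas (chart_mem_maximalAtlas p) (mem_chart_source_self p)

theorem chart_self (p : PL m) : chart p p = 0 := by
  have hm : (m : ℝ) ≠ 0 := NeZero.ne _
  rw [chart_apply, inv_mul_cancel, ← ofMatrix_one, coordOne_ofMatrix (by simp)]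
  apply SLAlg.mat_injective
  rw [mat_slPart]
  simp [hm]

theorem eq_of_mem_chart_source {p q : PL m} (h : q ∈ (chart p).source) :
    (1 + mat (chart p q)).det ≠ 0 ∧ q = p * ofMatrix (1 + mat (chart p q)) := by
  refine ⟨(chart p).map_source h, ?_⟩
  rw [← chart_symm_apply, (chart p).left_inv h]

/-- Multiplying by the class of a matrix depending smoothly on a parameter is smooth. -/
theorem contMDiffAt_mul_ofMatrix {V : Type*} [NormedAddCommGroup V] [NormedSpace ℝ V]
    {C : V → Matrix (Fin m) (Fin m) ℝ} (hC : ContDiff ℝ ∞ C) {v : V} (hv : C v = 1) (p : PL m) :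
    ContMDiffAt 𝓘(ℝ, V) 𝓘(ℝ, SLAlg m) ∞ (fun w ↦ p * ofMatrix (C w)) v := by
  have h0 : ∀ᶠ w in nhds v, (C w).det ≠ 0 ∧ (C w).trace ≠ 0 := by
    refine Filter.Eventually.and ?_ ?_
    · refine (hC.continuous.matrix_det.continuousAt).eventually_ne ?_
      simp [hv]
    · refine (hC.continuous.matrix_trace.continuousAt).eventually_ne ?_
      simp [hv, NeZero.ne]
  have hopen : IsOpen {A : Matrix (Fin m) (Fin m) ℝ | A.det ≠ 0 ∧ A.trace ≠ 0} :=
    (isOpen_ne_fun continuous_id.matrix_det continuous_const).inter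
      (isOpen_ne_fun continuous_id.matrix_trace continuous_const)
  have h1 : ContMDiffAt 𝓘(ℝ, V) 𝓘(ℝ, SLAlg m) ∞ (fun w ↦ coordOne (ofMatrix (C w))) v := by
    rw [contMDiffAt_iff_contDiffAt]
    exact ((contDiffOn_coordOne_ofMatrix.contDiffAt (hopen.mem_nhds h0.self_of_nhds)).comp v
      hC.contDiffAt)
  have h2 : coordOne (ofMatrix (C v)) ∈ (chart p).target := by
    have := (chart p).map_source (mem_chart_source_self p)
    rwa [chart_self, ← chart_self (1 : PL m), chart_apply, inv_one, mul_one, ← ofMatrix_one,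
      ← hv] at this
  have h3 := contMDiffOn_symm_of_mem_maximalAtlas (chart_mem_maximalAtlas p)
  have h4 := (h3.contMDiffAt ((chart p).open_target.mem_nhds h2)).comp v h1
  refine h4.congr_of_eventuallyEq ?_
  filter_upwards [h0] with w hw
  have hm : (m : ℝ) ≠ 0 := NeZero.ne _
  rw [Function.comp_apply, chart_symm_apply, one_add_coordOne hw.1 hw.2,
    ofMatrix_smul _ (div_ne_zero hm hw.2) _ hw.1]

instance : LieGroup 𝓘(ℝ, SLAlg m) ∞ (PL m) where
  contMDiff_mul := by
    rintro ⟨p, q⟩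
    obtain ⟨B, hB, hBq⟩ := exists_ofMatrix q
    have hB' : B⁻¹.det ≠ 0 := by simpa using hB
    have hBB : B⁻¹ * B = 1 := Matrix.nonsing_inv_mul B (isUnit_iff_ne_zero.2 hB)
    have hBq' : ofMatrix B⁻¹ = q⁻¹ := by
      rw [eq_inv_iff_mul_eq_one, ← hBq, ← ofMatrix_mul hB' hB, hBB, ofMatrix_one]
    let C : SLAlg m × SLAlg m → Matrix (Fin m) (Fin m) ℝ :=
      fun w ↦ B⁻¹ * (1 + mat w.1) * (B * (1 + mat w.2))
    have hC : ContDiff ℝ ∞ C :=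
      contDiff_matrix_mul (contDiff_matrix_mul contDiff_const (contDiff_one_add.comp contDiff_fst))
        (contDiff_matrix_mul contDiff_const (contDiff_one_add.comp contDiff_snd))
    have h1 := contMDiffAt_mul_ofMatrix hC (v := (chart p p, chart q q))
      (by simp [C, chart_self, hBB]) (p * q)
    have h2 : ContMDiffAt (𝓘(ℝ, SLAlg m).prod 𝓘(ℝ, SLAlg m)) 𝓘(ℝ, SLAlg m × SLAlg m) ∞
        (fun x : PL m × PL m ↦ (chart p x.1, chart q x.2)) (p, q) :=
      ((contMDiffAt_chart p).comp (p, q) contMDiffAt_fst).prodMk_space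
        ((contMDiffAt_chart q).comp (p, q) contMDiffAt_snd)
    refine (h1.comp (p, q) h2).congr_of_eventuallyEq ?_
    have h3 : ∀ᶠ x in nhds (p, q), x.1 ∈ (chart p).source ∧ x.2 ∈ (chart q).source :=
      prod_mem_nhds ((chart p).open_source.mem_nhds (mem_chart_source_self p))
        ((chart q).open_source.mem_nhds (mem_chart_source_self q))
    filter_upwards [h3] with x hx
    obtain ⟨ha, ha'⟩ := eq_of_mem_chart_source hx.1
    obtain ⟨hb, hb'⟩ := eq_of_mem_chart_source hx.2
    have hd1 : (B⁻¹ * (1 + mat (chart p x.1))).det ≠ 0 := by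
      rw [Matrix.det_mul]; exact mul_ne_zero hB' ha
    have hd2 : (B * (1 + mat (chart q x.2))).det ≠ 0 := by
      rw [Matrix.det_mul]; exact mul_ne_zero hB hb
    simp only [Function.comp_apply, C]
    rw [ofMatrix_mul hd1 hd2, ofMatrix_mul hB' ha, ofMatrix_mul hB hb, hBq, hBq']
    nth_rewrite 1 [ha', hb']
    group
  contMDiff_inv := by
    intro p
    obtain ⟨B, hB, hBp⟩ := exists_ofMatrix p
    have hB' : B⁻¹.det ≠ 0 := by simpa using hB
    have hBB : B * B⁻¹ = 1 := Matrix.mul_nonsing_inv B (isUnit_iff_ne_zero.2 hB)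
    have hBp' : ofMatrix B⁻¹ = p⁻¹ := by
      rw [eq_inv_iff_mul_eq_one, ← hBp, ← ofMatrix_mul hB' hB, Matrix.nonsing_inv_mul B
        (isUnit_iff_ne_zero.2 hB), ofMatrix_one]
    let C : SLAlg m → Matrix (Fin m) (Fin m) ℝ :=
      fun w ↦ B * (1 + mat w).adjugate * B⁻¹
    have hC : ContDiff ℝ ∞ C :=
      contDiff_matrix_mul (contDiff_matrix_mul contDiff_const (contDiff_adjugate contDiff_one_add))
        contDiff_const
    have h1 := contMDiffAt_mul_ofMatrix hC (v := chart p p)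
      (by simp [C, chart_self, hBB]) p⁻¹
    refine (h1.comp p (contMDiffAt_chart p)).congr_of_eventuallyEq ?_
    filter_upwards [(chart p).open_source.mem_nhds (mem_chart_source_self p)] with x hx
    obtain ⟨ha, ha'⟩ := eq_of_mem_chart_source hx
    have had : (1 + mat (chart p x)).adjugate.det ≠ 0 := by
      rw [Matrix.det_adjugate]; exact pow_ne_zero _ ha
    have hainv : ofMatrix (1 + mat (chart p x)).adjugate =
        (ofMatrix (1 + mat (chart p x)))⁻¹ := by
      rw [eq_inv_iff_mul_eq_one, ← ofMatrix_mul had ha, Matrix.adjugate_mul,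
        ofMatrix_smul _ ha _ (by simp), ofMatrix_one]
    simp only [Function.comp_apply, C]
    rw [ofMatrix_mul (by rw [Matrix.det_mul]; exact mul_ne_zero hB had) hB', ofMatrix_mul hB had,
      hBp, hBp', hainv]
    nth_rewrite 1 [ha']
    group

end PL

section Connections

variable {E : Type*} [NormedAddCommGroup E] [NormedSpace ℝ E] {H : Type*} [TopologicalSpace H]
  {I : ModelWithCorners ℝ E H} {M : Type*} [TopologicalSpace M] [ChartedSpace H M]
  {E' : Type*} [NormedAddCommGroup E'] [NormedSpace ℝ E'] {H' : Type*} [TopologicalSpace H']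
  {I' : ModelWithCorners ℝ E' H'} {M' : Type*} [TopologicalSpace M'] [ChartedSpace H' M']

/-- A family of vectors in a fixed tangent space that is differentiable as a map to the tangent
bundle is differentiable as a vector-valued map. -/
theorem mdifferentiableAt_fiber [IsManifold I 1 M] {x₀ : M} {f : M' → E} {y₀ : M'}
    (h : MDifferentiableAt I' I.tangent
      (fun y ↦ (TotalSpace.mk' E x₀ (f y) : TangentBundle I M)) y₀) :
    MDifferentiableAt I' 𝓘(ℝ, E) f y₀ := by
  have h2 := ((mdifferentiableAt_totalSpace (E := (TangentSpace I : M → Type _)) I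
    (fun y ↦ (TotalSpace.mk' E x₀ (f y) : TangentBundle I M))).1 h).2
  refine h2.congr_of_eventuallyEq (Filter.Eventually.of_forall fun y ↦ ?_)
  exact (tangentCoordChange_self (I := I) (x := x₀) (z := x₀) (v := f y)
    (mem_extChartAt_source x₀)).symm

/-- The linear connections on a manifold: covariant derivatives on its tangent bundle. -/
abbrev LinearConnection (I : ModelWithCorners ℝ E H) (M : Type*) [TopologicalSpace M]
    [ChartedSpace H M] [IsManifold I 1 M] : Type _ :=
  CovariantDerivative I E (TangentSpace I : M → Type _)

section Product

variable [IsManifold I 1 M] [IsManifold I' 1 M']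

theorem mdifferentiableAt_slices {σ : Π z : M × M', TangentSpace (I.prod I') z} {z : M × M'}
    (hσ : MDiffAt (T% σ) z) :
    (MDifferentiableAt I I.tangent
      (fun x ↦ (TotalSpace.mk' E x (σ (x, z.2)).1 : TangentBundle I M)) z.1 ∧
    MDifferentiableAt I' 𝓘(ℝ, E) (fun y ↦ ((σ (z.1, y)).1 : E)) z.2) ∧
    (MDifferentiableAt I' I'.tangent
      (fun y ↦ (TotalSpace.mk' E' y (σ (z.1, y)).2 : TangentBundle I' M')) z.2 ∧
    MDifferentiableAt I 𝓘(ℝ, E') (fun x ↦ ((σ (x, z.2)).2 : E')) z.1) := by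
  have h1 := ((contMDiff_equivTangentBundleProd (I := I) (I' := I') (M := M) (M' := M')
      (n := 1)).mdifferentiable one_ne_zero (T% σ z)).comp z hσ
  have h2 : MDifferentiableAt (I.prod I') I.tangent
      (fun w ↦ (TotalSpace.mk' E w.1 (σ w).1 : TangentBundle I M)) z :=
    mdifferentiableAt_fst.comp z h1
  have h3 : MDifferentiableAt (I.prod I') I'.tangent
      (fun w ↦ (TotalSpace.mk' E' w.2 (σ w).2 : TangentBundle I' M')) z :=
    mdifferentiableAt_snd.comp z h1
  have h4 : MDifferentiableAt I (I.prod I') (fun x : M ↦ (x, z.2)) z.1 :=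
    mdifferentiableAt_id.prodMk mdifferentiableAt_const
  have h5 : MDifferentiableAt I' (I.prod I') (fun y : M' ↦ (z.1, y)) z.2 :=
    mdifferentiableAt_const.prodMk mdifferentiableAt_id
  have h6 : MDifferentiableAt I I'.tangent
      (fun x ↦ (TotalSpace.mk' E' z.2 (σ (x, z.2)).2 : TangentBundle I' M')) z.1 :=
    MDifferentiableAt.comp z.1 (I' := I.prod I') (f := fun x : M ↦ (x, z.2))
      (g := fun w ↦ (TotalSpace.mk' E' w.2 (σ w).2 : TangentBundle I' M')) h3 h4
  have h7 : MDifferentiableAt I' I.tangent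
      (fun y ↦ (TotalSpace.mk' E z.1 (σ (z.1, y)).1 : TangentBundle I M)) z.2 :=
    MDifferentiableAt.comp z.2 (I' := I.prod I') (f := fun y : M' ↦ (z.1, y))
      (g := fun w ↦ (TotalSpace.mk' E w.1 (σ w).1 : TangentBundle I M)) h2 h5
  exact ⟨⟨h2.comp z.1 h4, mdifferentiableAt_fiber h7⟩,
    ⟨h3.comp z.2 h5, mdifferentiableAt_fiber h6⟩⟩

/-- The product connection: in the directions of each factor it differentiates the component
tangent to that factor with the given connection, and the other component, which along that
factor takes values in a fixed vector space, in the ordinary sense. -/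
def LinearConnection.prod (cov : LinearConnection I M) (cov' : LinearConnection I' M') :
    LinearConnection (I.prod I') (M × M') where
  toFun σ z :=
    let A : E →L[ℝ] E := cov (fun x ↦ (σ (x, z.2)).1) z.1
    let B : E' →L[ℝ] E := mvfderiv I' (fun y ↦ ((σ (z.1, y)).1 : E)) z.2
    let A' : E' →L[ℝ] E' := cov' (fun y ↦ (σ (z.1, y)).2) z.2
    let B' : E →L[ℝ] E' := mvfderiv I (fun x ↦ ((σ (x, z.2)).2 : E')) z.1
    (A.coprod B).prod (B'.coprod A')
  isCovariantDerivativeOnUniv := by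
    constructor
    · intro σ τ z hσ hτ _
      obtain ⟨⟨h1, h2⟩, h3, h4⟩ := mdifferentiableAt_slices hσ
      obtain ⟨⟨k1, k2⟩, k3, k4⟩ := mdifferentiableAt_slices hτ
      have e1 := cov.isCovariantDerivativeOnUniv.add h1 k1
      have e2 := cov'.isCovariantDerivativeOnUniv.add h3 k3
      have e3 := mvfderiv_add h2 k2
      have e4 := mvfderiv_add h4 k4
      refine ContinuousLinearMap.ext fun v ↦ ?_
      have e1v := congrArg (fun L : E →L[ℝ] E ↦ L v.1) e1
      have e2v := congrArg (fun L : E' →L[ℝ] E' ↦ L v.2) e2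
      have e3v := congrArg (fun L : E' →L[ℝ] E ↦ L v.2) e3
      have e4v := congrArg (fun L : E →L[ℝ] E' ↦ L v.1) e4
      exact Prod.ext ((congrArg₂ (· + ·) e1v e3v).trans (add_add_add_comm _ _ _ _))
        ((congrArg₂ (· + ·) e4v e2v).trans (add_add_add_comm _ _ _ _))
    · intro σ g z hσ hg _
      obtain ⟨⟨h1, h2⟩, h3, h4⟩ := mdifferentiableAt_slices hσ
      have g1 : MDifferentiableAt I 𝓘(ℝ, ℝ) (fun x ↦ g (x, z.2)) z.1 :=
        MDifferentiableAt.comp z.1 (I' := I.prod I') hg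
          (mdifferentiableAt_id.prodMk mdifferentiableAt_const)
      have g2 : MDifferentiableAt I' 𝓘(ℝ, ℝ) (fun y ↦ g (z.1, y)) z.2 :=
        MDifferentiableAt.comp z.2 (I' := I.prod I') hg
          (mdifferentiableAt_const.prodMk mdifferentiableAt_id)
      have e1 := cov.isCovariantDerivativeOnUniv.leibniz h1 g1
      have e2 := cov'.isCovariantDerivativeOnUniv.leibniz h3 g2
      have e3 := mvfderiv_smul g2 h2
      have e4 := mvfderiv_smul g1 h4
      refine ContinuousLinearMap.ext fun v ↦ ?_
      have e1v := congrArg (fun L : E →L[ℝ] E ↦ L v.1) e1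
      have e2v := congrArg (fun L : E' →L[ℝ] E' ↦ L v.2) e2
      have e3v := congrArg (fun L : E' →L[ℝ] E ↦ L v.2) e3
      have e4v := congrArg (fun L : E →L[ℝ] E' ↦ L v.1) e4
      have e5 : (mvfderiv (I.prod I') g z : E × E' →L[ℝ] ℝ) v =
          (mvfderiv I (fun x ↦ g (x, z.2)) z.1 : E →L[ℝ] ℝ) v.1 +
            (mvfderiv I' (fun y ↦ g (z.1, y)) z.2 : E' →L[ℝ] ℝ) v.2 :=
        mfderiv_prod_eq_add_apply hg
      refine Prod.ext ((congrArg₂ (· + ·) e1v e3v).trans ?_)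
        ((congrArg₂ (· + ·) e4v e2v).trans ?_)
      · let A : E →L[ℝ] E := cov (fun x ↦ (σ (x, z.2)).1) z.1
        let B : E' →L[ℝ] E := mvfderiv I' (fun y ↦ ((σ (z.1, y)).1 : E)) z.2
        let w : E := (σ z).1
        refine Eq.trans ?_ (congrArg (fun r : ℝ ↦ g z • (A v.1 + B v.2) + r • w) e5.symm)
        rw [add_smul, smul_add]
        exact add_add_add_comm _ _ _ _
      · let A' : E' →L[ℝ] E' := cov' (fun y ↦ (σ (z.1, y)).2) z.2
        let B' : E →L[ℝ] E' := mvfderiv I (fun x ↦ ((σ (x, z.2)).2 : E')) z.1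
        let w : E' := (σ z).2
        refine Eq.trans ?_ (congrArg (fun r : ℝ ↦ g z • (B' v.1 + A' v.2) + r • w) e5.symm)
        rw [add_smul, smul_add]
        exact add_add_add_comm _ _ _ _

end Product

section LeftInvariant

variable {G : Type*} [TopologicalSpace G] [ChartedSpace H G] [Group G] [LieGroup I ∞ G]

/-- The Maurer-Cartan form `T_g G → T_1 G`, the derivative at `g` of left translation by `g⁻¹`
(the model space `E` is the tangent space at the identity). -/
def maurerCartan (I : ModelWithCorners ℝ E H) (g : G) : TangentSpace I g →L[ℝ] E :=
  mfderiv I I (fun h ↦ g⁻¹ * h) g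

/-- The derivative at `1` of left translation by `g`, the inverse of the Maurer-Cartan form. -/
def leftTranslation (I : ModelWithCorners ℝ E H) (g : G) : E →L[ℝ] TangentSpace I g :=
  mfderiv I I (fun h ↦ g * h) (1 : G)

theorem mdifferentiable_leftMul (g : G) : MDifferentiable I I fun h : G ↦ g * h :=
  (contMDiff_mul_left (I := I) (n := ∞) (a := g)).mdifferentiable (by simp)

theorem leftTranslation_maurerCartan (g : G) (v : TangentSpace I g) :
    leftTranslation I g (maurerCartan I g v) = v := by
  have h : (fun h : G ↦ g * h) ∘ (fun h ↦ g⁻¹ * h) = id := by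
    funext h; simp
  have h1 := mfderiv_comp_of_eq (I := I) (I' := I) (I'' := I) (x := g) (y := 1)
    (mdifferentiable_leftMul (I := I) g 1) (mdifferentiable_leftMul g⁻¹ g) (inv_mul_cancel g)
  rw [h, mfderiv_id] at h1
  have key : ∀ k : G, k = 1 → (mfderiv I I (fun h ↦ g * h) k : E →L[ℝ] E) =
      mfderiv I I (fun h ↦ g * h) (1 : G) := by
    rintro k rfl; rfl
  have h2 := congrArg (fun L : E →L[ℝ] E ↦ L (maurerCartan I g v)) (key _ (inv_mul_cancel g))
  exact h2.symm.trans (congrArg (fun L : E →L[ℝ] E ↦ L v) h1).symm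

theorem maurerCartan_leftTranslation (g : G) (v : E) :
    maurerCartan I g (leftTranslation I g v) = v := by
  have h : (fun h : G ↦ g⁻¹ * h) ∘ (fun h ↦ g * h) = id := by
    funext h; simp
  have h1 := mfderiv_comp_of_eq (I := I) (I' := I) (I'' := I) (x := (1 : G)) (y := g)
    (mdifferentiable_leftMul (I := I) g⁻¹ g) (mdifferentiable_leftMul g 1) (mul_one g)
  rw [h, mfderiv_id] at h1
  have key : ∀ k : G, k = g → (mfderiv I I (fun h ↦ g⁻¹ * h) k : E →L[ℝ] E) =
      mfderiv I I (fun h ↦ g⁻¹ * h) g := by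
    rintro k rfl; rfl
  have h2 := congrArg (fun L : E →L[ℝ] E ↦ L (leftTranslation I g v)) (key _ (mul_one g))
  exact h2.symm.trans (congrArg (fun L : E →L[ℝ] E ↦ L v) h1).symm

theorem mdifferentiableAt_maurerCartan {σ : Π g : G, TangentSpace I g} {g : G}
    (hσ : MDiffAt (T% σ) g) :
    MDifferentiableAt I 𝓘(ℝ, E) (fun h ↦ maurerCartan I h (σ h)) g := by
  have hmul : ContMDiff (I.prod I) I 2 fun p : G × G ↦ p.1 * p.2 :=
    (contMDiff_mul I ∞).of_le ENat.LEInfty.out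
  have hT : MDifferentiable (I.prod I).tangent I.tangent
      (tangentMap (I.prod I) I fun p : G × G ↦ p.1 * p.2) :=
    (hmul.contMDiff_tangentMap (m := 1) (by norm_num)).mdifferentiable one_ne_zero
  have hS : MDifferentiable (I.tangent.prod I.tangent) (I.prod I).tangent
      (equivTangentBundleProd I G I G).symm :=
    (contMDiff_equivTangentBundleProd_symm (n := 1)).mdifferentiable one_ne_zero
  have h0 : MDifferentiable I I.tangent
      (fun h : G ↦ (TotalSpace.mk' E h⁻¹ (0 : TangentSpace I h⁻¹) : TangentBundle I G)) :=
    (mdifferentiable_zeroSection ℝ (TangentSpace I : G → Type _)).comp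
      ((contMDiff_inv I ∞).mdifferentiable (by simp))
  have h1 := (hT _).comp g ((hS _).comp g ((h0 g).prodMk hσ))
  refine mdifferentiableAt_fiber (I := I) (x₀ := (1 : G)) (h1.congr_of_eventuallyEq
    (Filter.Eventually.of_forall fun h ↦ ?_))
  have key : ∀ (k : G) (w : E), k = 1 → (TotalSpace.mk' E 1 w : TangentBundle I G) =
      TotalSpace.mk' E k w := by
    rintro k w rfl; rfl
  refine (key (h⁻¹ * h) _ (inv_mul_cancel h)).trans ?_
  refine congrArg (TotalSpace.mk' E (h⁻¹ * h)) ?_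
  have h2 := mfderiv_prod_eq_add_apply (I := I) (I' := I) (I'' := I) (p := (h⁻¹, h))
    (v := ((0 : E), (σ h : E))) ((hmul.mdifferentiable (by simp)) (h⁻¹, h))
  refine Eq.trans ?_ h2.symm
  refine ((congrArg (· + (maurerCartan I h (σ h))) ?_).trans (zero_add _)).symm
  exact map_zero _

/-- The left invariant connection with `∇_X Y = B(X, Y)` for left invariant vector fields `X`, `Y`
(identified with their values at the identity). -/
def leftInvariantConnection (B : E →L[ℝ] E →L[ℝ] E) : LinearConnection I G where
  toFun σ g := leftTranslation I g ∘L
    (mvfderiv I (fun h ↦ maurerCartan I h (σ h)) g +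
      (B.flip (maurerCartan I g (σ g))) ∘L maurerCartan I g)
  isCovariantDerivativeOnUniv := by
    constructor
    · intro σ τ g hσ hτ _
      have h1 : (fun h ↦ maurerCartan I h ((σ + τ) h)) =
          (fun h ↦ maurerCartan I h (σ h)) + fun h ↦ maurerCartan I h (τ h) := by
        funext h; exact map_add _ _ _
      have h2 : maurerCartan I g ((σ + τ) g) = maurerCartan I g (σ g) + maurerCartan I g (τ g) :=
        map_add _ _ _
      rw [h1, h2, mvfderiv_add (mdifferentiableAt_maurerCartan hσ)
        (mdifferentiableAt_maurerCartan hτ), map_add, ContinuousLinearMap.add_comp,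
        ← ContinuousLinearMap.comp_add, add_add_add_comm]
    · intro σ f g hσ hf _
      have h1 : (fun h ↦ maurerCartan I h ((f • σ) h)) =
          f • fun h ↦ maurerCartan I h (σ h) := by
        funext h; exact map_smul _ _ _
      have h2 : maurerCartan I g ((f • σ) g) = f g • maurerCartan I g (σ g) := map_smul _ _ _
      rw [h1, h2, mvfderiv_smul hf (mdifferentiableAt_maurerCartan hσ)]
      ext v
      have h3 := leftTranslation_maurerCartan g (σ g)
      simp [h3]
      exact add_right_comm _ _ _

theorem leftInvariantConnection_apply (B : E →L[ℝ] E →L[ℝ] E) (v w : E) (g : G) :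
    leftInvariantConnection (I := I) B (fun h ↦ leftTranslation I h w) g (leftTranslation I g v) =
      leftTranslation I g (B v w) := by
  simp only [leftInvariantConnection, maurerCartan_leftTranslation, mvfderiv_const, zero_add,
    ContinuousLinearMap.comp_apply, ContinuousLinearMap.flip_apply]

end LeftInvariant

namespace LinearConnection

section Curvature

variable [IsManifold I 1 M]

/-- `R(X, Y)Z = ∇_X ∇_Y Z - ∇_Y ∇_X Z - ∇_[X, Y] Z` for vector fields `X`, `Y`, `Z`. -/
def curvatureField (cov : LinearConnection I M) (X Y Z : Π x : M, TangentSpace I x) (x : M) :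
    TangentSpace I x :=
  cov (fun y ↦ cov Z y (Y y)) x (X x) - cov (fun y ↦ cov Z y (X y)) x (Y x) -
    cov Z x (VectorField.mlieBracket I X Y x)

/-- The curvature tensor `R(u, v)w` of a smooth connection, computed with extensions of the
tangent vectors to vector fields that are smooth near the point. -/
def curvature (cov : LinearConnection I M) (x : M) (u v w : TangentSpace I x) :
    TangentSpace I x :=
  curvatureField cov (FiberBundle.extend E u) (FiberBundle.extend E v) (FiberBundle.extend E w) x

/-- The Ricci tensor `Ric(v, w) = tr (u ↦ R(u, v)w)`. -/
def ricci [FiniteDimensional ℝ E] (cov : LinearConnection I M) (x : M) (v w : TangentSpace I x) : ℝ :=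
  ∑ i, (Module.finBasis ℝ E).coord i (curvature cov x (Module.finBasis ℝ E i) v w)

end Curvature

/-- A connection is affinely flat if its torsion and its curvature vanish. -/
def IsAffinelyFlat [FiniteDimensional ℝ E] [IsManifold I ∞ M]
    (cov : LinearConnection I M) : Prop :=
  cov.torsion = 0 ∧ ∀ (x : M) (u v w : TangentSpace I x), curvature cov x u v w = 0

end LinearConnection

section Projective

variable [IsManifold I 1 M]

/-- Smoothness on a set of a 1-form. -/
def IsSmoothOneFormOn (p : Π x : M, TangentSpace I x →L[ℝ] ℝ) (s : Set M) : Prop :=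
  ContMDiffOn I (I.prod 𝓘(ℝ, E →L[ℝ] ℝ)) ∞
    (fun x ↦ TotalSpace.mk' (E →L[ℝ] ℝ)
      (E := fun x : M ↦ TangentSpace I x →L[ℝ] Bundle.Trivial M ℝ x) x (p x)) s

namespace LinearConnection

/-- Projective equivalence: `∇'_X Y = ∇_X Y + p(X)Y + p(Y)X` for a smooth 1-form `p`. -/
def IsProjectivelyEquivalent (cov cov' : LinearConnection I M) : Prop :=
  ∃ p : Π x : M, TangentSpace I x →L[ℝ] ℝ, IsSmoothOneFormOn p Set.univ ∧
    ∀ (Y : Π x : M, TangentSpace I x) (x : M), MDiffAt (T% Y) x → ∀ v : TangentSpace I x,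
      cov' Y x v = cov Y x v + p x v • Y x + p x (Y x) • v

/-- A connection is projectively flat if near every point there is a diffeomorphism `φ` onto an
open subset of the model vector space which carries it to a connection that is projectively
equivalent to the standard flat connection `(X, Y) ↦ D_X Y`. -/
def IsProjectivelyFlat (cov : LinearConnection I M) : Prop :=
  ∀ x₀ : M, ∃ φ : OpenPartialHomeomorph M E, x₀ ∈ φ.source ∧
    ContMDiffOn I 𝓘(ℝ, E) ∞ φ φ.source ∧ ContMDiffOn 𝓘(ℝ, E) I ∞ φ.symm φ.target ∧
    ∃ p : Π x : M, TangentSpace I x →L[ℝ] ℝ, IsSmoothOneFormOn p φ.source ∧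
      ∀ (Y : Π x : M, TangentSpace I x), ∀ x ∈ φ.source, MDiffAt (T% Y) x →
        ∀ v : TangentSpace I x,
          mvfderiv I φ x (cov Y x v) =
            mvfderiv I (fun y ↦ mvfderiv I φ y (Y y)) x v +
              p x v • mvfderiv I φ x (Y x) + p x (Y x) • mvfderiv I φ x v

end LinearConnection

end Projective

end Connections

/-- The connection `∇_m` on `PL(m)`: the left invariant connection such that
`∇_Y Z = YZ - (tr(YZ) / m) I` for left invariant vector fields `Y, Z ∈ 𝔰𝔩(m)`. The tangent space of
`PL(m)` at the identity is `𝔰𝔩(m)` by means of the chart `[A] ↦ (m / tr A) A - I`, in which the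
curve `[exp(tX)]` has velocity `X` at `t = 0`. -/
def nablaPL (m : ℕ) [NeZero m] : LinearConnection 𝓘(ℝ, SLAlg m) (PL m) :=
  leftInvariantConnection (I := 𝓘(ℝ, SLAlg m)) (G := PL m)
    (LinearMap.toContinuousBilinearMap
      ((LinearMap.mul ℝ (Matrix (Fin m) (Fin m) ℝ)).compl₁₂ mat mat |>.compr₂ (slPart m)))

theorem nablaPL_apply (m : ℕ) [NeZero m] (Y Z : SLAlg m) (g : PL m) :
    nablaPL m (fun h ↦ leftTranslation 𝓘(ℝ, SLAlg m) h Z) g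
      (leftTranslation 𝓘(ℝ, SLAlg m) g Y) =
      leftTranslation 𝓘(ℝ, SLAlg m) g (slPart m (mat Y * mat Z)) :=
  leftInvariantConnection_apply _ _ _ _

end

/-! Work in the left invariant frame, with B(Y, Z) the trace-free part of YZ, and write ∇' as the
projective change of ∇_m by a 1-form p. The connection ∇_m is torsion free (`PL.leftBracket_eq`),
and associativity of the matrix product leaves only trace terms in its curvature: R(x, y)z =
(tr(xz)/m) y - (tr(yz)/m) x (`PL.bilin_bilin_sub`). The projective change adds terms in dp and in
S(x, z) = x(p(z)) - p(x)p(z) - p(B(x, z)) (`maurerCartan_curvatureField`). On the diagonal dp drops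
out, and Ric'(y, y) = (1 - N)(tr(y²)/m + S(y, y)) with N = m² - 1 the dimension.

Suppose Ric'(y, y) vanished for all y. If X² = 0, then B(X, X) = 0 and the equation reads X(p(X)) =
p(X)². The curve g(1 + tX) is an integral curve of X defined for all real t, so p(X) along it solves
u' = u² on the whole line. Nonzero solutions blow up in finite time (`eq_zero_of_hasDerivAt_sq`),
hence p(X) = 0. Matrices of square zero span 𝔰𝔩(m) (`PL.linearMap_eq_zero_of_sq_zero`), so p = 0,
and what remains is tr(y²) = 0 for all y, which fails for diag(1, -1, 0, ...). This gives the second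
claim, and the first follows because zero curvature has zero Ricci tensor.

For the third claim, a projectively flat connection has curvature R(X, Y)Z = dp(X, Y)Z + S(X, Z)Y -
S(Y, Z)X, now with p the form coming from the flat chart and S its Schouten-type expression
(`LinearConnection.mvfderiv_curvatureField`). In a product the mixed curvatures vanish. Inserting a
nonzero vector u of the first factor isolates each coefficient as a multiple of u: R(u, Y')Z' = 0
gives S(Y', Z') = 0, and R(X', Y')u = 0 gives dp(X', Y') = 0. So the second factor has no curvature
at all (`LinearConnection.curvatureField_eq_zero_of_isProjectivelyFlat_prod`), against the
nonvanishing of its Ricci tensor. -/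

noncomputable section

open SLAlg (mat)

/-! ### Lie brackets as commutators of derivations, and brackets of related fields. -/

section Bracket

variable {E : Type*} [NormedAddCommGroup E] [NormedSpace ℝ E] {H : Type*} [TopologicalSpace H]
  {I : ModelWithCorners ℝ E H} {M : Type*} [TopologicalSpace M] [ChartedSpace H M]
  {E' : Type*} [NormedAddCommGroup E'] [NormedSpace ℝ E'] {H' : Type*} [TopologicalSpace H']
  {I' : ModelWithCorners ℝ E' H'} {M' : Type*} [TopologicalSpace M'] [ChartedSpace H' M']
  {F : Type*} [NormedAddCommGroup F] [NormedSpace ℝ F]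

/-- The chain rule for vector-valued functions. -/
theorem mvfderiv_comp_mfderiv {g : M' → F} {f : M → M'} {x : M}
    (hg : MDifferentiableAt I' 𝓘(ℝ, F) g (f x)) (hf : MDifferentiableAt I I' f x)
    (v : TangentSpace I x) :
    mvfderiv I (fun y ↦ g (f y)) x v = mvfderiv I' g (f x) (mfderiv I I' f x v) :=
  mfderiv_comp_apply x hg hf v

theorem mvfderiv_fderiv_comp {V : Type*} [NormedAddCommGroup V] [NormedSpace ℝ V]
    {g : V → F} {f : M → V} {x : M}
    (hg : DifferentiableAt ℝ g (f x)) (hf : MDifferentiableAt I 𝓘(ℝ, V) f x)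
    (v : TangentSpace I x) :
    mvfderiv I (fun y ↦ g (f y)) x v = fderiv ℝ g (f x) (mvfderiv I f x v) := by
  have h := mvfderiv_comp_mfderiv hg.mdifferentiableAt hf v
  rw [h]
  exact congrArg (fun L : V →L[ℝ] F ↦ L (mvfderiv I f x v)) (mfderiv_eq_fderiv (f := g) (x := f x))

theorem mvfderiv_congr {f g : M → F} {x : M} (h : f =ᶠ[nhds x] g) :
    (mvfderiv I f x : E →L[ℝ] F) = mvfderiv I g x :=
  h.mfderiv_eq

/-- The derivative of a function, computed in a chart. -/
theorem mvfderiv_eq_fderiv_extChartAt [I.Boundaryless] [IsManifold I 1 M] {f : M → F} {x y : M}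
    (hy : y ∈ (extChartAt I x).source) (hf : MDifferentiableAt I 𝓘(ℝ, F) f y)
    (v : TangentSpace I y) :
    mvfderiv I f y v = fderiv ℝ (f ∘ (extChartAt I x).symm) (extChartAt I x y)
      (mvfderiv I (extChartAt I x) y v) := by
  have h1 : MDifferentiableAt 𝓘(ℝ, E) I (extChartAt I x).symm (extChartAt I x y) :=
    ((contMDiffOn_extChartAt_symm (n := 1) x).contMDiffAt
      ((isOpen_extChartAt_target x).mem_nhds ((extChartAt I x).map_source hy))).mdifferentiableAt
      one_ne_zero
  have h2 : MDifferentiableAt I 𝓘(ℝ, E) (extChartAt I x) y := mdifferentiableAt_extChartAt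
    (by rwa [extChartAt_source] at hy)
  have h3 : DifferentiableAt ℝ (f ∘ (extChartAt I x).symm) (extChartAt I x y) := by
    rw [← mdifferentiableAt_iff_differentiableAt]
    refine MDifferentiableAt.comp _ (I' := I) ?_ h1
    rwa [(extChartAt I x).left_inv hy]
  rw [← mvfderiv_fderiv_comp h3 h2]
  refine congrArg (fun L : E →L[ℝ] F ↦ L v) (mvfderiv_congr ?_)
  filter_upwards [(isOpen_extChartAt_source x).mem_nhds hy] with z hz
  exact congrArg f ((extChartAt I x).left_inv hz).symm

/-- The pullback is formed with the inverse of the derivative of the inverse chart, and this is the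
derivative of the chart. It links derivatives in a chart to the pullbacks through which the manifold
Lie bracket is defined. -/
theorem mvfderiv_extChartAt_eq_mpullback [I.Boundaryless] [IsManifold I 1 M]
    (X : Π x : M, TangentSpace I x) {x y : M}
    (hy : y ∈ (extChartAt I x).source) :
    mvfderiv I (extChartAt I x) y (X y) =
      VectorField.mpullbackWithin 𝓘(ℝ, E) I (extChartAt I x).symm X (Set.range I)
        (extChartAt I x y) := by
  have h1 := mfderivWithin_extChartAt_symm_comp_mfderiv_extChartAt' (I := I) hy
  have h2 := isInvertible_mfderivWithin_extChartAt_symm (I := I) ((extChartAt I x).map_source hy)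
  rw [VectorField.mpullbackWithin_apply]
  -- The base points agree only up to `left_inv`, so the claim is generalised over the point and the
  -- linear map before the equality is substituted.
  have key : ∀ z : M, z = y → ∀ L : E →L[ℝ] TangentSpace I z, L.IsInvertible →
      (∀ v : E, (L : E →L[ℝ] E) (mvfderiv I (extChartAt I x) y v) = v) →
      (mvfderiv I (extChartAt I x) y : E →L[ℝ] E) (X y) = L.inverse (X z) := by
    rintro z rfl L ⟨e, rfl⟩ hL
    rw [ContinuousLinearMap.inverse_equiv]
    have := hL (X z)
    exact ((e.symm_apply_apply _).symm.trans (congrArg e.symm this))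
  refine key _ ((extChartAt I x).left_inv hy) _ h2 fun v ↦ ?_
  exact congrArg (fun L : E →L[ℝ] E ↦ L v) h1

/-- The Lie bracket acts on functions as the commutator of derivations. -/
theorem mvfderiv_mlieBracket [I.Boundaryless] [IsManifold I 2 M] [CompleteSpace E] {f : M → F}
    {X Y : Π x : M, TangentSpace I x} {x : M} (hf : ContMDiffAt I 𝓘(ℝ, F) 2 f x)
    (hX : MDiffAt (T% X) x) (hY : MDiffAt (T% Y) x) :
    mvfderiv I f x (VectorField.mlieBracket I X Y x) =
      mvfderiv I (fun y ↦ mvfderiv I f y (Y y)) x (X x) -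
        mvfderiv I (fun y ↦ mvfderiv I f y (X y)) x (Y x) := by
  have : IsManifold I 1 M := IsManifold.of_le (n := 2) one_le_two
  have hx := mem_extChartAt_source (I := I) x
  set X' := VectorField.mpullbackWithin 𝓘(ℝ, E) I (extChartAt I x).symm X (Set.range I) with hX'
  set Y' := VectorField.mpullbackWithin 𝓘(ℝ, E) I (extChartAt I x).symm Y (Set.range I) with hY'
  have hfx : ∀ᶠ y in nhds x, MDifferentiableAt I 𝓘(ℝ, F) f y := by
    filter_upwards [(contMDiffAt_iff_contMDiffAt_nhds (by simp)).1 hf] with y hy using hy.mdifferentiableAt two_ne_zero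
  have hs := (isOpen_extChartAt_source (I := I) x).mem_nhds hx
  have hsymm : ContMDiffAt 𝓘(ℝ, E) I 2 (extChartAt I x).symm (extChartAt I x x) :=
    (contMDiffOn_extChartAt_symm (n := 2) x).contMDiffAt
      ((isOpen_extChartAt_target x).mem_nhds ((extChartAt I x).map_source hx))
  have hf' : ContDiffAt ℝ 2 (f ∘ (extChartAt I x).symm) (extChartAt I x x) := by
    rw [← contMDiffAt_iff_contDiffAt]
    refine ContMDiffAt.comp _ (I' := I) ?_ hsymm
    rwa [(extChartAt I x).left_inv hx]
  have hd : ∀ {Z : Π x : M, TangentSpace I x}, MDiffAt (T% Z) x → DifferentiableAt ℝ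
      (VectorField.mpullbackWithin 𝓘(ℝ, E) I (extChartAt I x).symm Z (Set.range I))
      (extChartAt I x x) := by
    intro Z hZ
    have h := (mdifferentiableWithinAt_univ.2
      hZ).differentiableWithinAt_mpullbackWithin_vectorField
    exact h.differentiableAt (by simp [I.range_eq_univ])
  have hD : ∀ Z : Π x : M, TangentSpace I x, (fun y ↦ mvfderiv I f y (Z y)) =ᶠ[nhds x]
      fun y ↦ (fun e ↦ fderiv ℝ (f ∘ (extChartAt I x).symm) e
        (VectorField.mpullbackWithin 𝓘(ℝ, E) I (extChartAt I x).symm Z (Set.range I) e))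
        (extChartAt I x y) := by
    intro Z
    filter_upwards [hs, hfx] with y hy hfy
    rw [mvfderiv_eq_fderiv_extChartAt hy hfy, mvfderiv_extChartAt_eq_mpullback _ hy]
  -- In the chart, an iterated derivative along two fields is an iterated Fréchet derivative along
  -- their pullbacks; this reduces the claim to the bracket formula in a vector space.
  have hDD : ∀ Z W : Π x : M, TangentSpace I x, MDiffAt (T% Z) x →
      mvfderiv I (fun y ↦ mvfderiv I f y (Z y)) x (W x) =
        fderiv ℝ (fun e ↦ fderiv ℝ (f ∘ (extChartAt I x).symm) e
        (VectorField.mpullbackWithin 𝓘(ℝ, E) I (extChartAt I x).symm Z (Set.range I) e))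
        (extChartAt I x x) (VectorField.mpullbackWithin 𝓘(ℝ, E) I (extChartAt I x).symm W
          (Set.range I) (extChartAt I x x)) := by
    intro Z W hZ
    rw [← mvfderiv_extChartAt_eq_mpullback _ hx, ← mvfderiv_fderiv_comp]
    · exact congrArg (fun L : E →L[ℝ] F ↦ L (W x)) (mvfderiv_congr (hD Z))
    · exact ((hf'.fderiv_right (m := 1) le_rfl).differentiableAt one_ne_zero).clm_apply (hd hZ)
    · exact mdifferentiableAt_extChartAt (mem_chart_source H x)
  rw [hDD _ _ hX, hDD _ _ hY, mvfderiv_eq_fderiv_extChartAt hx hfx.self_of_nhds,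
    ← VectorField.fderiv_apply_lieBracket hf' (by simp) (hd hY) (hd hX)]
  congr 1
  rw [← VectorField.mlieBracketWithin_univ, VectorField.mlieBracketWithin_apply]
  rw [Set.preimage_univ, Set.univ_inter]
  have hinv := isInvertible_mfderiv_extChartAt (I := I) hx
  have hr : VectorField.lieBracketWithin ℝ X' Y' (Set.range I) (extChartAt I x x) =
      VectorField.lieBracket ℝ X' Y' (extChartAt I x x) := by
    have key : ∀ s : Set E, s = Set.univ → VectorField.lieBracketWithin ℝ X' Y' s =
        VectorField.lieBracket ℝ X' Y' := by
      rintro _ rfl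
      exact VectorField.lieBracketWithin_univ
    exact congrFun (key _ I.range_eq_univ) _
  rw [← hr]
  obtain ⟨e, he⟩ : ∃ e : E ≃L[ℝ] E, (e : E →L[ℝ] E) = mfderiv I 𝓘(ℝ, E) (extChartAt I x) x := hinv
  have key : ∀ L : E →L[ℝ] E, (e : E →L[ℝ] E) = L → ∀ v : E, L (L.inverse v) = v := by
    rintro _ rfl v
    rw [ContinuousLinearMap.inverse_equiv]
    exact e.apply_symm_apply v
  exact key _ he _

/-- The Lie brackets of related vector fields are related. -/
theorem mfderiv_mlieBracket [I.Boundaryless] [IsManifold I 2 M] [CompleteSpace E]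
    [I'.Boundaryless] [IsManifold I' 2 M'] [CompleteSpace E'] {f : M → M'}
    {X Y : Π x : M, TangentSpace I x} {X' Y' : Π x : M', TangentSpace I' x} {x : M}
    (hf : ContMDiffAt I I' 2 f x)
    (hX : MDiffAt (T% X) x) (hY : MDiffAt (T% Y) x)
    (hX' : MDiffAt (T% X') (f x)) (hY' : MDiffAt (T% Y') (f x))
    (hXX' : ∀ᶠ y in nhds x, mfderiv I I' f y (X y) = X' (f y))
    (hYY' : ∀ᶠ y in nhds x, mfderiv I I' f y (Y y) = Y' (f y)) :
    mfderiv I I' f x (VectorField.mlieBracket I X Y x) =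
      VectorField.mlieBracket I' X' Y' (f x) := by
  have : IsManifold I' 1 M' := IsManifold.of_le (n := 2) one_le_two
  have hs := mem_extChartAt_source (I := I') (f x)
  have hc : ∀ᶠ y in nhds (f x), ContMDiffAt I' 𝓘(ℝ, E') 2 (extChartAt I' (f x)) y := by
    filter_upwards [(isOpen_extChartAt_source (I := I') (f x)).mem_nhds hs] with y hy
    exact contMDiffAt_extChartAt' (by rwa [extChartAt_source] at hy)
  have hc' := hf.continuousAt.eventually hc
  have hfy : ∀ᶠ y in nhds x, MDifferentiableAt I I' f y := by
    filter_upwards [(contMDiffAt_iff_contMDiffAt_nhds (by simp)).1 hf] with y hy using hy.mdifferentiableAt two_ne_zero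
  -- Test both brackets on the chart of the target at `f x`: relatedness turns derivatives upstairs
  -- of the composed chart into derivatives downstairs, and the chart's derivative is injective.
  have hD : ∀ (Z : Π x : M, TangentSpace I x) (Z' : Π x : M', TangentSpace I' x),
      (∀ᶠ y in nhds x, mfderiv I I' f y (Z y) = Z' (f y)) →
      (fun y ↦ mvfderiv I (fun z ↦ extChartAt I' (f x) (f z)) y (Z y)) =ᶠ[nhds x]
        fun y ↦ (fun w ↦ mvfderiv I' (extChartAt I' (f x)) w (Z' w)) (f y) := by
    intro Z Z' h
    filter_upwards [h, hc', hfy] with y hy hcy hfy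
    rw [mvfderiv_comp_mfderiv (hcy.mdifferentiableAt two_ne_zero) hfy, hy]
  have hm : ∀ (Z' : Π x : M', TangentSpace I' x), MDiffAt (T% Z') (f x) →
      MDifferentiableAt I' 𝓘(ℝ, E') (fun w ↦ mvfderiv I' (extChartAt I' (f x)) w (Z' w)) (f x) := by
    intro Z' hZ'
    have h := (mdifferentiableWithinAt_univ.2
      hZ').differentiableWithinAt_mpullbackWithin_vectorField
    have h2 := (h.differentiableAt (by simp [I'.range_eq_univ])).mdifferentiableAt.comp (f x)
      (mdifferentiableAt_extChartAt (I := I') (mem_chart_source H' (f x)))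
    refine h2.congr_of_eventuallyEq ?_
    filter_upwards [(isOpen_extChartAt_source (I := I') (f x)).mem_nhds hs] with y hy
    exact mvfderiv_extChartAt_eq_mpullback _ hy
  have hDD : ∀ (Z : Π x : M, TangentSpace I x) (Z' : Π x : M', TangentSpace I' x)
      (W : Π x : M, TangentSpace I x) (W' : Π x : M', TangentSpace I' x),
      (∀ᶠ y in nhds x, mfderiv I I' f y (Z y) = Z' (f y)) → MDiffAt (T% Z') (f x) →
      (∀ᶠ y in nhds x, mfderiv I I' f y (W y) = W' (f y)) →
      mvfderiv I (fun y ↦ mvfderiv I (fun z ↦ extChartAt I' (f x) (f z)) y (Z y)) x (W x) =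
        mvfderiv I' (fun w ↦ mvfderiv I' (extChartAt I' (f x)) w (Z' w)) (f x) (W' (f x)) := by
    intro Z Z' W W' h hZ' hW
    rw [← hW.self_of_nhds, ← mvfderiv_comp_mfderiv (hm _ hZ') hfy.self_of_nhds]
    exact congrArg (fun L : E →L[ℝ] E' ↦ L (W x)) (mvfderiv_congr (hD _ _ h))
  have h1 := mvfderiv_mlieBracket (hc.self_of_nhds.comp x hf) hX hY
  have h2 := mvfderiv_mlieBracket hc.self_of_nhds hX' hY'
  change mvfderiv I (fun z ↦ extChartAt I' (f x) (f z)) x _ =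
    mvfderiv I (fun y ↦ mvfderiv I (fun z ↦ extChartAt I' (f x) (f z)) y (Y y)) x (X x) -
    mvfderiv I (fun y ↦ mvfderiv I (fun z ↦ extChartAt I' (f x) (f z)) y (X y)) x (Y x) at h1
  rw [hDD _ _ _ _ hXX' hX' hYY', hDD _ _ _ _ hYY' hY' hXX', ← h2, mvfderiv_comp_mfderiv
    (hc.self_of_nhds.mdifferentiableAt two_ne_zero) hfy.self_of_nhds] at h1
  obtain ⟨e, he⟩ : ∃ e : E' ≃L[ℝ] E', (e : E' →L[ℝ] E') =
    mfderiv I' 𝓘(ℝ, E') (extChartAt I' (f x)) (f x) := isInvertible_mfderiv_extChartAt (I := I') hs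
  have key : ∀ L : E' →L[ℝ] E', (e : E' →L[ℝ] E') = L → ∀ v w : E', L v = L w → v = w := by
    rintro _ rfl v w h
    exact e.injective h
  exact key _ he _ _ h1

end Bracket

/-! ### Curvature of a projectively flat connection. -/

section ProjectivelyFlat

variable {E : Type*} [NormedAddCommGroup E] [NormedSpace ℝ E] {H : Type*} [TopologicalSpace H]
  {I : ModelWithCorners ℝ E H} {M : Type*} [TopologicalSpace M] [ChartedSpace H M]
  {F : Type*} [NormedAddCommGroup F] [NormedSpace ℝ F]

/-- For finite order, smoothness at a point persists on an open neighbourhood, where the tangent map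
within the set is the tangent map. One order of differentiability is lost. -/
theorem contMDiffAt_tangentMap [IsManifold I ∞ M] {f : M → F} {m : ℕ}
    {q : TangentBundle I M} (hf : ContMDiffAt I 𝓘(ℝ, F) ((m + 1 : ℕ) : ℕ∞ω) f q.1) :
    ContMDiffAt I.tangent 𝓘(ℝ, F).tangent m (tangentMap I 𝓘(ℝ, F) f) q := by
  have h1 : IsManifold I ((m + 1 : ℕ) : ℕ∞ω) M := IsManifold.of_le (n := ∞) (by exact_mod_cast le_top)
  have h2 : IsManifold I 1 M := IsManifold.of_le (n := ∞) (by simp)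
  obtain ⟨u, hu, hxu, hfu⟩ : ∃ u : Set M, IsOpen u ∧ q.1 ∈ u ∧
      ContMDiffOn I 𝓘(ℝ, F) ((m + 1 : ℕ) : ℕ∞ω) f u := by
    obtain ⟨u, hu, hux, h⟩ := mem_nhds_iff.1
      ((contMDiffAt_iff_contMDiffAt_nhds (by exact_mod_cast ENat.natCast_ne_top _)).1 hf)
    exact ⟨u, hux, h, fun y hy ↦ (hu hy).contMDiffWithinAt⟩
  have h3 := hfu.contMDiffOn_tangentMapWithin (m := m) (by norm_cast) hu.uniqueMDiffOn
  have ho : IsOpen (Bundle.TotalSpace.proj ⁻¹' u : Set (TangentBundle I M)) :=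
    hu.preimage (FiberBundle.continuous_proj E (TangentSpace I))
  refine (h3.contMDiffAt (ho.mem_nhds hxu)).congr_of_eventuallyEq ?_
  filter_upwards [ho.mem_nhds hxu] with y hy
  exact (tangentMapWithin_eq_tangentMap (hu.uniqueMDiffOn _ hy)
    ((hfu.contMDiffAt (hu.mem_nhds hy)).mdifferentiableAt (by simp))).symm

theorem contMDiffAt_mvfderiv_apply [IsManifold I ∞ M] {f : M → F} {m : ℕ}
    {Z : Π x : M, TangentSpace I x} {x : M}
    (hf : ContMDiffAt I 𝓘(ℝ, F) ((m + 1 : ℕ) : ℕ∞ω) f x) (hZ : ContMDiffAt I I.tangent m (T% Z) x) :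
    ContMDiffAt I 𝓘(ℝ, F) m (fun y ↦ mvfderiv I f y (Z y)) x :=
  (contMDiff_snd_tangentBundle_modelSpace F 𝓘(ℝ, F)).contMDiffAt.comp x
    ((contMDiffAt_tangentMap (q := ⟨x, Z x⟩) hf).comp (f := T% Z) x hZ)

theorem mdifferentiableAt_mvfderiv_apply [IsManifold I ∞ M] {f : M → F}
    {Z : Π x : M, TangentSpace I x} {x : M}
    (hf : ContMDiffAt I 𝓘(ℝ, F) 2 f x) (hZ : MDiffAt (T% Z) x) :
    MDifferentiableAt I 𝓘(ℝ, F) (fun y ↦ mvfderiv I f y (Z y)) x :=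
  ((contMDiff_snd_tangentBundle_modelSpace F 𝓘(ℝ, F)
    (n := 1)).contMDiffAt.mdifferentiableAt one_ne_zero).comp x
    (((contMDiffAt_tangentMap (m := 1) (q := ⟨x, Z x⟩) hf).mdifferentiableAt
      (by simp)).comp (f := T% Z) x hZ)

theorem mvfderiv_congr_apply {f g : M → F} {x : M} (h : f =ᶠ[nhds x] g) (v : TangentSpace I x) :
    mvfderiv I f x v = mvfderiv I g x v :=
  congrArg (fun L : E →L[ℝ] F ↦ L v) (mvfderiv_congr h)

theorem mvfderiv_add_apply {f g : M → F} {x : M} (hf : MDifferentiableAt I 𝓘(ℝ, F) f x)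
    (hg : MDifferentiableAt I 𝓘(ℝ, F) g x) (v : TangentSpace I x) :
    mvfderiv I (fun y ↦ f y + g y) x v = mvfderiv I f x v + mvfderiv I g x v :=
  congrArg (fun L : E →L[ℝ] F ↦ L v) (mvfderiv_fun_add hf hg)

theorem mvfderiv_smul_apply {a : M → ℝ} {f : M → F} {x : M} (ha : MDifferentiableAt I 𝓘(ℝ, ℝ) a x)
    (hf : MDifferentiableAt I 𝓘(ℝ, F) f x) (v : TangentSpace I x) :
    mvfderiv I (fun y ↦ a y • f y) x v = a x • mvfderiv I f x v + mvfderiv I a x v • f x :=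
  congrArg (fun L : E →L[ℝ] F ↦ L v) (mvfderiv_fun_smul ha hf)

/-- The three summands have the shape of a covariant derivative after a projective change, so this
is the rule for differentiating such an expression once more. -/
theorem mvfderiv_add_smul_add_smul {f g h : M → F} {a b : M → ℝ} {x : M}
    (hf : MDifferentiableAt I 𝓘(ℝ, F) f x) (ha : MDifferentiableAt I 𝓘(ℝ, ℝ) a x)
    (hg : MDifferentiableAt I 𝓘(ℝ, F) g x) (hb : MDifferentiableAt I 𝓘(ℝ, ℝ) b x)
    (hh : MDifferentiableAt I 𝓘(ℝ, F) h x) (v : TangentSpace I x) :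
    mvfderiv I (fun y ↦ f y + a y • g y + b y • h y) x v =
      mvfderiv I f x v + (a x • mvfderiv I g x v + mvfderiv I a x v • g x) +
        (b x • mvfderiv I h x v + mvfderiv I b x v • h x) := by
  have h1 : MDifferentiableAt I 𝓘(ℝ, F) (fun y ↦ a y • g y) x := ha.smul hg
  have h2 : MDifferentiableAt I 𝓘(ℝ, F) (fun y ↦ b y • h y) x := hb.smul hh
  have h3 : MDifferentiableAt I 𝓘(ℝ, F) (fun y ↦ f y + a y • g y) x := hf.add h1
  rw [mvfderiv_add_apply h3 h2, mvfderiv_add_apply hf h1, mvfderiv_smul_apply ha hg,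
    mvfderiv_smul_apply hb hh]

theorem mdifferentiableAt_oneForm_apply [IsManifold I 1 M]
    {p : Π x : M, TangentSpace I x →L[ℝ] ℝ} {Z : Π x : M, TangentSpace I x} {x : M}
    (hp : MDifferentiableAt I (I.prod 𝓘(ℝ, E →L[ℝ] ℝ)) (fun x ↦ TotalSpace.mk' (E →L[ℝ] ℝ)
      (E := fun x : M ↦ TangentSpace I x →L[ℝ] Bundle.Trivial M ℝ x) x (p x)) x)
    (hZ : MDiffAt (T% Z) x) :
    MDifferentiableAt I 𝓘(ℝ, ℝ) (fun y ↦ p y (Z y)) x := by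
  have h := MDifferentiableAt.clm_bundle_apply (F₁ := E) (F₂ := ℝ) (E₁ := (TangentSpace I : M → Type _))
    (E₂ := Bundle.Trivial M ℝ) (b := fun y ↦ y) (ϕ := p) hp hZ
  exact ((mdifferentiableAt_section (s := fun y ↦ p y (Z y)) I).1 h)

namespace LinearConnection

variable [IsManifold I 1 M]

/-- The quantity `X(p(Z)) + p(X)p(Z) - p(∇_X Z)` attached to a 1-form `p` and a connection. -/
def schouten (cov : LinearConnection I M) (p : Π x : M, TangentSpace I x →L[ℝ] ℝ)
    (X Z : Π x : M, TangentSpace I x) (x : M) : ℝ :=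
  mvfderiv I (fun y ↦ p y (Z y)) x (X x) + p x (X x) * p x (Z x) - p x (cov Z x (X x))

/-- The exterior derivative of a 1-form on two vector fields. -/
def extDer (p : Π x : M, TangentSpace I x →L[ℝ] ℝ)
    (X Y : Π x : M, TangentSpace I x) (x : M) : ℝ :=
  mvfderiv I (fun y ↦ p y (Y y)) x (X x) - mvfderiv I (fun y ↦ p y (X y)) x (Y x) -
    p x (VectorField.mlieBracket I X Y x)

/-- The curvature of a connection that a local map `φ` carries to one projectively equivalent to
the flat connection. -/
theorem mvfderiv_curvatureField [CompleteSpace E] [I.Boundaryless] [IsManifold I ∞ M]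
    (cov : LinearConnection I M) {φ : M → F} {p : Π x : M, TangentSpace I x →L[ℝ] ℝ} {x : M}
    (hφ : ContMDiffAt I 𝓘(ℝ, F) 3 φ x)
    (hp : MDifferentiableAt I (I.prod 𝓘(ℝ, E →L[ℝ] ℝ)) (fun x ↦ TotalSpace.mk' (E →L[ℝ] ℝ)
      (E := fun x : M ↦ TangentSpace I x →L[ℝ] Bundle.Trivial M ℝ x) x (p x)) x)
    (hcov : ∀ᶠ y in nhds x, ∀ Y : Π x : M, TangentSpace I x, MDiffAt (T% Y) y →
      ∀ v : TangentSpace I y, mvfderiv I φ y (cov Y y v) =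
        mvfderiv I (fun y ↦ mvfderiv I φ y (Y y)) y v +
          p y v • mvfderiv I φ y (Y y) + p y (Y y) • mvfderiv I φ y v)
    {X Y Z : Π x : M, TangentSpace I x}
    (hX : MDiffAt (T% X) x) (hY : MDiffAt (T% Y) x)
    (hZ : ContMDiffAt I I.tangent 2 (T% Z) x)
    (hXZ : MDiffAt (T% fun y ↦ cov Z y (X y)) x) (hYZ : MDiffAt (T% fun y ↦ cov Z y (Y y)) x) :
    mvfderiv I φ x (curvatureField cov X Y Z x) =
      extDer p X Y x • mvfderiv I φ x (Z x) + schouten cov p X Z x • mvfderiv I φ x (Y x) -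
        schouten cov p Y Z x • mvfderiv I φ x (X x) := by
  have h2 : IsManifold I 2 M := IsManifold.of_le (n := ∞) ENat.LEInfty.out
  have hφ2 : ContMDiffAt I 𝓘(ℝ, F) 2 φ x := hφ.of_le (by norm_cast)
  have hZd : ∀ᶠ y in nhds x, MDiffAt (T% Z) y := by
    filter_upwards [(contMDiffAt_iff_contMDiffAt_nhds (by simp)).1 hZ] with y hy
      using hy.mdifferentiableAt two_ne_zero
  have hFZ := contMDiffAt_mvfderiv_apply (m := 2) hφ hZ
  have hpZ := mdifferentiableAt_oneForm_apply hp hZd.self_of_nhds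
  -- The second covariant derivative of Z along W and then V, seen through φ. The hypothesis on
  -- `cov` is used twice, first for the field `cov Z W` and then for Z itself under the derivative.
  have hDD : ∀ {V W : Π x : M, TangentSpace I x}, MDiffAt (T% W) x →
      MDiffAt (T% fun y ↦ cov Z y (W y)) x →
      mvfderiv I φ x (cov (fun y ↦ cov Z y (W y)) x (V x)) =
        mvfderiv I (fun y ↦ mvfderiv I (fun y ↦ mvfderiv I φ y (Z y)) y (W y)) x (V x) +
        (mvfderiv I (fun y ↦ p y (W y)) x (V x) • mvfderiv I φ x (Z x) +
          p x (W x) • mvfderiv I (fun y ↦ mvfderiv I φ y (Z y)) x (V x)) +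
        (mvfderiv I (fun y ↦ p y (Z y)) x (V x) • mvfderiv I φ x (W x) +
          p x (Z x) • mvfderiv I (fun y ↦ mvfderiv I φ y (W y)) x (V x)) +
        p x (V x) • (mvfderiv I (fun y ↦ mvfderiv I φ y (Z y)) x (W x) +
          p x (W x) • mvfderiv I φ x (Z x) + p x (Z x) • mvfderiv I φ x (W x)) +
        p x (cov Z x (W x)) • mvfderiv I φ x (V x) := by
    intro V W hW hWZ
    have e1 := hcov.self_of_nhds _ hWZ (V x)
    have e2 := hcov.self_of_nhds _ hZd.self_of_nhds (W x)
    have e3 : (fun y ↦ mvfderiv I φ y (cov Z y (W y))) =ᶠ[nhds x]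
      fun y ↦ mvfderiv I (fun y ↦ mvfderiv I φ y (Z y)) y (W y) +
          p y (W y) • mvfderiv I φ y (Z y) + p y (Z y) • mvfderiv I φ y (W y) := by
      filter_upwards [hcov, hZd] with y hy hZy using hy Z hZy (W y)
    have hpW := mdifferentiableAt_oneForm_apply hp hW
    have m1 := mdifferentiableAt_mvfderiv_apply hFZ hW
    have m2 := mdifferentiableAt_mvfderiv_apply hφ2 hZd.self_of_nhds
    have m3 := mdifferentiableAt_mvfderiv_apply hφ2 hW
    have e4 := mvfderiv_congr_apply e3 (V x)
    rw [e1, e4, mvfderiv_add_smul_add_smul m1 hpW m2 hpZ m3, e2]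
    module
  -- Antisymmetrising leaves brackets acting on φ and on the derivative of φ along Z; these two
  -- identities cancel every second derivative, so only terms in p survive.
  have hb := mvfderiv_mlieBracket hFZ hX hY
  have hb2 := mvfderiv_mlieBracket hφ2 hX hY
  have e1 := hDD (V := X) hY hYZ
  have e2 := hDD (V := Y) hX hXZ
  have e3 := hcov.self_of_nhds _ hZd.self_of_nhds (VectorField.mlieBracket I X Y x)
  rw [curvatureField, map_sub, map_sub, e1, e2, e3, hb, hb2, schouten, schouten, extDer]
  module

end LinearConnection

end ProjectivelyFlat

/-! ### The left invariant frame of a Lie group. -/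

section LieGroupFrame

variable {E : Type*} [NormedAddCommGroup E] [NormedSpace ℝ E] {H : Type*} [TopologicalSpace H]
  {I : ModelWithCorners ℝ E H}
  {G : Type*} [TopologicalSpace G] [ChartedSpace H G] [Group G] [LieGroup I ∞ G]

theorem contMDiff_leftTranslation (v : E) :
    ContMDiff I I.tangent 2 (T% fun g : G ↦ leftTranslation I g v) := by
  have : LieGroup I (minSmoothness ℝ 3) G := LieGroup.of_le (n := ∞) (by simp; exact ENat.LEInfty.out)
  have h := contMDiff_mulInvariantVectorField (I := I) (G := G) v
  simp only [minSmoothness_of_isRCLikeNormedField] at h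
  exact h

theorem mdifferentiableAt_leftTranslation (v : E) (g : G) :
    MDiffAt (T% fun g : G ↦ leftTranslation I g v) g :=
  (contMDiff_leftTranslation v g).mdifferentiableAt two_ne_zero

/-- Expanding the coefficient function in a basis writes the field as a finite combination of left
invariant fields with differentiable coefficients. -/
theorem mdifferentiableAt_leftTranslation_apply [FiniteDimensional ℝ E] {y : G → E} {g : G}
    (hy : MDifferentiableAt I 𝓘(ℝ, E) y g) :
    MDiffAt (T% fun g : G ↦ leftTranslation I g (y g)) g := by
  have : IsManifold I 1 G := IsManifold.of_le (n := ∞) (by simp)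
  let b := Module.finBasis ℝ E
  have h1 : ∀ g : G, leftTranslation I g (y g) =
      ∑ i, (b.coord i (y g)) • leftTranslation I g (b i) := by
    intro g
    conv_lhs => rw [← b.sum_repr (y g)]
    rw [map_sum]
    exact Finset.sum_congr rfl fun i _ ↦ map_smul _ _ _
  have h2 : MDiffAt (T% fun g : G ↦ ∑ i, (b.coord i (y g)) • leftTranslation I g (b i)) g := by
    refine MDifferentiableAt.sum_section fun i _ ↦ MDifferentiableAt.smul_section ?_
      (mdifferentiableAt_leftTranslation (b i) g)
    exact ((LinearMap.toContinuousLinearMap (b.coord i)).mdifferentiableAt).comp g hy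
  exact h2.congr_of_eventuallyEq (Filter.Eventually.of_forall fun h ↦
    congrArg (TotalSpace.mk' E h) (h1 h))

theorem contMDiffAt_fiber {n : ℕ} {x₀ : G} {f : G → E} {y₀ : G}
    (h : ContMDiffAt I I.tangent n (fun y ↦ (TotalSpace.mk' E x₀ (f y) : TangentBundle I G)) y₀) :
    ContMDiffAt I 𝓘(ℝ, E) n f y₀ := by
  have : IsManifold I 1 G := IsManifold.of_le (n := ∞) (by simp)
  have h2 := ((contMDiffAt_totalSpace (E := (TangentSpace I : G → Type _))
    (f := fun y ↦ (TotalSpace.mk' E x₀ (f y) : TangentBundle I G))).1 h).2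
  refine h2.congr_of_eventuallyEq (Filter.Eventually.of_forall fun y ↦ ?_)
  exact (tangentCoordChange_self (I := I) (x := x₀) (z := x₀) (v := f y)
    (mem_extChartAt_source x₀)).symm

/-- The Maurer-Cartan form on σ(h) is the tangent map of multiplication on the pair (0 at h⁻¹, σ(h)
at h), which is smooth in h and lands in the fixed tangent space at the identity. -/
theorem contMDiffAt_maurerCartan {σ : Π g : G, TangentSpace I g} {g : G}
    (hσ : ContMDiffAt I I.tangent 2 (T% σ) g) :
    ContMDiffAt I 𝓘(ℝ, E) 2 (fun h ↦ maurerCartan I h (σ h)) g := by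
  have : IsManifold I (2 + 1) G := IsManifold.of_le (n := ∞) (by norm_num; exact ENat.LEInfty.out)
  have hmul : ContMDiff (I.prod I) I 3 fun p : G × G ↦ p.1 * p.2 :=
    (contMDiff_mul I ∞).of_le ENat.LEInfty.out
  have hT : ContMDiff (I.prod I).tangent I.tangent 2
      (tangentMap (I.prod I) I fun p : G × G ↦ p.1 * p.2) :=
    hmul.contMDiff_tangentMap (m := 2) (by norm_num)
  have hS : ContMDiff (I.tangent.prod I.tangent) (I.prod I).tangent 2
      (equivTangentBundleProd I G I G).symm := contMDiff_equivTangentBundleProd_symm (n := 2)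
  have h0 : ContMDiff I I.tangent 2
      (fun h : G ↦ (TotalSpace.mk' E h⁻¹ (0 : TangentSpace I h⁻¹) : TangentBundle I G)) :=
    (contMDiff_zeroSection ℝ (TangentSpace I : G → Type _)).comp
      ((contMDiff_inv I ∞).of_le ENat.LEInfty.out)
  have h1 := (hT _).comp g ((hS _).comp g ((h0 g).prodMk hσ))
  refine contMDiffAt_fiber (I := I) (n := 2) (x₀ := (1 : G)) (h1.congr_of_eventuallyEq
    (Filter.Eventually.of_forall fun h ↦ ?_))
  have key : ∀ (k : G) (w : E), k = 1 → (TotalSpace.mk' E 1 w : TangentBundle I G) =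
      TotalSpace.mk' E k w := by
    rintro k w rfl; rfl
  refine (key (h⁻¹ * h) _ (inv_mul_cancel h)).trans ?_
  refine congrArg (TotalSpace.mk' E (h⁻¹ * h)) ?_
  have h2 := mfderiv_prod_eq_add_apply (I := I) (I' := I) (I'' := I) (p := (h⁻¹, h))
    (v := ((0 : E), (σ h : E))) ((hmul.mdifferentiable (by simp)) (h⁻¹, h))
  refine Eq.trans ?_ h2.symm
  refine ((congrArg (· + (maurerCartan I h (σ h))) ?_).trans (zero_add _)).symm
  exact map_zero _

/-- The Lie bracket on the tangent space at the identity of left invariant vector fields. -/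
def leftBracket (I : ModelWithCorners ℝ E H) (G : Type*) [TopologicalSpace G] [ChartedSpace H G]
    [Group G] [LieGroup I ∞ G] (x y : E) : E :=
  VectorField.mlieBracket I (fun g : G ↦ leftTranslation I g x) (fun g ↦ leftTranslation I g y)
    (1 : G)

theorem mlieBracket_leftTranslation [CompleteSpace E] (x y : E) (g : G) :
    VectorField.mlieBracket I (fun g : G ↦ leftTranslation I g x) (fun g ↦ leftTranslation I g y) g =
      leftTranslation I g (leftBracket I G x y) := by
  have : LieGroup I (minSmoothness ℝ 3) G := LieGroup.of_le (n := ∞) (by simp; exact ENat.LEInfty.out)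
  exact (congrFun (mulInvariantVector_mlieBracket (I := I) (G := G) x y) g).symm

/-- The torsion of the left invariant connection with B = 0 is a tensor, so it takes the same value
on X, Y as on the left invariant fields that agree with them at g. For the latter all covariant
derivatives vanish and only the bracket of the Lie algebra remains. -/
theorem maurerCartan_mlieBracket [FiniteDimensional ℝ E] {X Y : Π g : G, TangentSpace I g} {g : G}
    (hX : MDiffAt (T% X) g) (hY : MDiffAt (T% Y) g) :
    maurerCartan I g (VectorField.mlieBracket I X Y g) =
      mvfderiv I (fun h ↦ maurerCartan I h (Y h)) g (X g) -
        mvfderiv I (fun h ↦ maurerCartan I h (X h)) g (Y g) +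
        leftBracket I G (maurerCartan I g (X g)) (maurerCartan I g (Y g)) := by
  have : CompleteSpace E := FiniteDimensional.complete ℝ E
  have : IsManifold I 2 G := IsManifold.of_le (n := ∞) ENat.LEInfty.out
  have e1 := (leftInvariantConnection (I := I) (G := G) 0).torsion_apply hX hY
  have e2 := (leftInvariantConnection (I := I) (G := G) 0).torsion_apply
    (mdifferentiableAt_leftTranslation (maurerCartan I g (X g)) g)
    (mdifferentiableAt_leftTranslation (maurerCartan I g (Y g)) g)
  rw [leftInvariantConnection_apply, leftInvariantConnection_apply, mlieBracket_leftTranslation,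
    leftTranslation_maurerCartan, leftTranslation_maurerCartan, e1] at e2
  have e3 := congrArg (maurerCartan I g) e2
  simp only [map_sub, maurerCartan_leftTranslation] at e3
  have e4 : ∀ X Y : Π g : G, TangentSpace I g,
      maurerCartan I g (leftInvariantConnection (I := I) (G := G) 0 Y g (X g)) =
      mvfderiv I (fun h ↦ maurerCartan I h (Y h)) g (X g) := by
    intro X Y
    refine (maurerCartan_leftTranslation g _).trans ?_
    exact add_zero _
  rw [e4, e4] at e3
  have e5 : ∀ a b c d : E, a - b - c = 0 - 0 - d → c = a - b + d := by
    intro a b c d h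
    rw [sub_eq_iff_eq_add] at h
    rw [h]; abel
  exact e5 _ _ _ _ e3

end LieGroupFrame

/-! ### Curvature of a projective change of a left invariant connection. -/

section LieGroupCurvature

variable {E : Type*} [NormedAddCommGroup E] [NormedSpace ℝ E] {H : Type*} [TopologicalSpace H]
  {I : ModelWithCorners ℝ E H}

theorem mdifferentiableAt_pi {M : Type*} [TopologicalSpace M] [ChartedSpace H M]
    {ι : Type*} [Fintype ι] {q : M → ι → ℝ} {x : M}
    (hq : ∀ i, MDifferentiableAt I 𝓘(ℝ, ℝ) (fun y ↦ q y i) x) :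
    MDifferentiableAt I 𝓘(ℝ, ι → ℝ) q x := by
  refine ⟨continuousWithinAt_pi.2 fun i ↦ (hq i).1, ?_⟩
  exact differentiableWithinAt_pi.2 fun i ↦ (hq i).2

theorem mvfderiv_bilin_apply {M : Type*} [TopologicalSpace M] [ChartedSpace H M]
    {F₁ F₂ F : Type*} [NormedAddCommGroup F₁] [NormedSpace ℝ F₁] [NormedAddCommGroup F₂]
    [NormedSpace ℝ F₂] [NormedAddCommGroup F] [NormedSpace ℝ F]
    (B : F₁ →L[ℝ] F₂ →L[ℝ] F) {f : M → F₁} {g : M → F₂}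
    {x : M} (hf : MDifferentiableAt I 𝓘(ℝ, F₁) f x) (hg : MDifferentiableAt I 𝓘(ℝ, F₂) g x)
    (v : TangentSpace I x) :
    mvfderiv I (fun y ↦ B (f y) (g y)) x v =
      B (mvfderiv I f x v) (g x) + B (f x) (mvfderiv I g x v) := by
  have h1 := hf.hasMFDerivAt
  have h2 := hg.hasMFDerivAt
  have h3 : HasMFDerivAt I 𝓘(ℝ, F₁ × F₂) (fun y ↦ (f y, g y)) x
      ((mvfderiv I f x : E →L[ℝ] F₁).prod (mvfderiv I g x : E →L[ℝ] F₂)) :=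
    ⟨h1.1.prodMk h2.1, h1.2.prodMk h2.2⟩
  have h4 := mvfderiv_fderiv_comp (I := I) (g := fun q : F₁ × F₂ ↦ B q.1 q.2)
    (f := fun y ↦ (f y, g y)) (x := x)
    (B.isBoundedBilinearMap.differentiableAt _) h3.mdifferentiableAt v
  refine h4.trans ?_
  have h5 : (mvfderiv I (fun y ↦ (f y, g y)) x : E →L[ℝ] F₁ × F₂) =
    (mvfderiv I f x : E →L[ℝ] F₁).prod (mvfderiv I g x : E →L[ℝ] F₂) := h3.mfderiv
  have h6 := congrArg (fun L : E →L[ℝ] F₁ × F₂ ↦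
    fderiv ℝ (fun q : F₁ × F₂ ↦ B q.1 q.2) (f x, g x) (L v)) h5
  refine h6.trans ?_
  rw [B.isBoundedBilinearMap.fderiv]
  exact add_comm _ _

variable {G : Type*} [TopologicalSpace G] [ChartedSpace H G] [Group G] [LieGroup I ∞ G]

/-- The value on left invariant vector fields of the exterior derivative of a 1-form. -/
def leftExtDer (p : Π g : G, TangentSpace I g →L[ℝ] ℝ) (g : G) (x y : E) : ℝ :=
  mvfderiv I (fun h ↦ p h (leftTranslation I h y)) g (leftTranslation I g x) -
    mvfderiv I (fun h ↦ p h (leftTranslation I h x)) g (leftTranslation I g y) -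
    p g (leftTranslation I g (leftBracket I G x y))

/-- The quantity `x(p(z)) - p(x)p(z) - p(B(x, z))` on left invariant vector fields. -/
def leftSchouten (B : E →L[ℝ] E →L[ℝ] E) (p : Π g : G, TangentSpace I g →L[ℝ] ℝ) (g : G)
    (x z : E) : ℝ :=
  mvfderiv I (fun h ↦ p h (leftTranslation I h z)) g (leftTranslation I g x) -
    p g (leftTranslation I g x) * p g (leftTranslation I g z) -
    p g (leftTranslation I g (B x z))

/-- The curvature, in the left invariant frame, of the connection obtained from the left invariant
connection `B` by a projective change with the 1-form `p`. -/
def leftCurvature (B : E →L[ℝ] E →L[ℝ] E) (p : Π g : G, TangentSpace I g →L[ℝ] ℝ) (g : G)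
    (x y z : E) : E :=
  B x (B y z) - B y (B x z) - B (leftBracket I G x y) z + leftExtDer p g x y • z +
    leftSchouten B p g x z • y - leftSchouten B p g y z • x

variable [IsManifold I 1 G] {cov : LinearConnection I G} {B : E →L[ℝ] E →L[ℝ] E}
  {p : Π g : G, TangentSpace I g →L[ℝ] ℝ}

/-- The product rule for the pairing of a 1-form with a vector field in the left invariant frame. -/
theorem mvfderiv_oneForm_apply [FiniteDimensional ℝ E]
    {g : G} (hp : MDifferentiableAt I (I.prod 𝓘(ℝ, E →L[ℝ] ℝ)) (fun x ↦ TotalSpace.mk' (E →L[ℝ] ℝ)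
      (E := fun x : G ↦ TangentSpace I x →L[ℝ] Bundle.Trivial G ℝ x) x (p x)) g)
    {Z : Π g : G, TangentSpace I g} (hZ : MDiffAt (T% Z) g)
    (v : TangentSpace I g) :
    mvfderiv I (fun h ↦ p h (Z h)) g v =
      mvfderiv I (fun h ↦ p h (leftTranslation I h (maurerCartan I g (Z g)))) g v +
        p g (leftTranslation I g (mvfderiv I (fun h ↦ maurerCartan I h (Z h)) g v)) := by
  let b := Module.finBasis ℝ E
  have hz := mdifferentiableAt_maurerCartan hZ
  have hq := fun i ↦ mdifferentiableAt_oneForm_apply hp (mdifferentiableAt_leftTranslation (b i) g)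
  let q : G → Fin (Module.finrank ℝ E) → ℝ := fun h i ↦ p h (leftTranslation I h (b i))
  have hq' : MDifferentiableAt I 𝓘(ℝ, Fin (Module.finrank ℝ E) → ℝ) q g :=
    mdifferentiableAt_pi hq
  -- In the left invariant frame a 1-form is its coordinate vector `q`, and pairing with a field is
  -- this fixed bilinear map, so the product rule for bilinear maps applies.
  let P : (Fin (Module.finrank ℝ E) → ℝ) →L[ℝ] E →L[ℝ] ℝ := LinearMap.toContinuousBilinearMap
    (LinearMap.mk₂ ℝ (fun q z ↦ ∑ i, q i * b.repr z i)
      (by intros; simp [add_mul, Finset.sum_add_distrib])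
      (by intros; simp [Finset.mul_sum, mul_assoc])
      (by intros; simp [mul_add, Finset.sum_add_distrib])
      (by intros; simp [Finset.mul_sum, mul_left_comm]))
  have hP : ∀ h z, p h (leftTranslation I h z) = P (q h) z := by
    intro h z
    conv_lhs => rw [← b.sum_repr z]
    rw [map_sum, map_sum]
    refine Finset.sum_congr rfl fun i _ ↦ ?_
    rw [map_smul, map_smul, smul_eq_mul, mul_comm]
  have e1 : (fun h ↦ p h (Z h)) = fun h ↦ P (q h) (maurerCartan I h (Z h)) := by
    funext h
    rw [← hP, leftTranslation_maurerCartan]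
  have e2 : (fun h ↦ p h (leftTranslation I h (maurerCartan I g (Z g)))) =
      fun h ↦ P (q h) (maurerCartan I g (Z g)) := by
    funext h
    rw [← hP]
  rw [e1, e2, hP, mvfderiv_bilin_apply P hq' hz]
  congr 1
  have e3 := mvfderiv_bilin_apply P hq' (mdifferentiableAt_const (c := maurerCartan I g (Z g))) v
  refine Eq.trans ?_ e3.symm
  rw [mvfderiv_const]
  simp

/-- In the frame the connection becomes the ordinary derivative plus B plus the two terms in p; all
curvature computations on the group use this form. -/
theorem maurerCartan_cov
    (hcov : ∀ (Y : Π g : G, TangentSpace I g) (g : G), MDiffAt (T% Y) g → ∀ v : TangentSpace I g,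
      cov Y g v = leftInvariantConnection B Y g v + p g v • Y g + p g (Y g) • v)
    {Y : Π g : G, TangentSpace I g} {g : G} (hY : MDiffAt (T% Y) g) (v : TangentSpace I g) :
    maurerCartan I g (cov Y g v) = mvfderiv I (fun h ↦ maurerCartan I h (Y h)) g v +
      B (maurerCartan I g v) (maurerCartan I g (Y g)) + p g v • maurerCartan I g (Y g) +
        p g (Y g) • maurerCartan I g v := by
  rw [hcov Y g hY v, map_add, map_add, map_smul, map_smul]
  congr 2
  exact maurerCartan_leftTranslation _ _

theorem mdifferentiableAt_of_maurerCartan [FiniteDimensional ℝ E] {Y : Π g : G, TangentSpace I g} {g : G}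
    (hY : MDifferentiableAt I 𝓘(ℝ, E) (fun h ↦ maurerCartan I h (Y h)) g) : MDiffAt (T% Y) g :=
  (mdifferentiableAt_leftTranslation_apply hY).congr_of_eventuallyEq
    (Filter.Eventually.of_forall fun h ↦
      congrArg (TotalSpace.mk' E h) (leftTranslation_maurerCartan h (Y h)).symm)

/-- Curvature differentiates a covariant derivative, so that field must itself be differentiable. It
is enough to see this for its components in the frame. -/
theorem mdifferentiableAt_cov [I.Boundaryless] [FiniteDimensional ℝ E]
    (hcov : ∀ (Y : Π g : G, TangentSpace I g) (g : G), MDiffAt (T% Y) g → ∀ v : TangentSpace I g,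
      cov Y g v = leftInvariantConnection B Y g v + p g v • Y g + p g (Y g) • v)
    {g : G} (hp : MDifferentiableAt I (I.prod 𝓘(ℝ, E →L[ℝ] ℝ)) (fun x ↦ TotalSpace.mk' (E →L[ℝ] ℝ)
      (E := fun x : G ↦ TangentSpace I x →L[ℝ] Bundle.Trivial G ℝ x) x (p x)) g)
    {W Z : Π g : G, TangentSpace I g} (hW : MDiffAt (T% W) g)
    (hZ : ContMDiffAt I I.tangent 2 (T% Z) g) :
    MDiffAt (T% fun h ↦ cov Z h (W h)) g := by
  apply mdifferentiableAt_of_maurerCartan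
  have hZd : ∀ᶠ y in nhds g, MDiffAt (T% Z) y := by
    filter_upwards [(contMDiffAt_iff_contMDiffAt_nhds (by simp)).1 hZ] with y hy
      using hy.mdifferentiableAt two_ne_zero
  have hz := mdifferentiableAt_maurerCartan hZd.self_of_nhds
  have hw := mdifferentiableAt_maurerCartan hW
  have m1 := mdifferentiableAt_mvfderiv_apply (contMDiffAt_maurerCartan hZ) hW
  have m2 : MDifferentiableAt I 𝓘(ℝ, E) (fun h ↦ B (maurerCartan I h (W h)) (maurerCartan I h (Z h))) g := by
    exact (B.mdifferentiableAt.comp g hw).clm_apply hz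
  have m3 := (mdifferentiableAt_oneForm_apply hp hW).smul hz
  have m4 := (mdifferentiableAt_oneForm_apply hp hZd.self_of_nhds).smul hw
  refine (((m1.add m2).add m3).add m4).congr_of_eventuallyEq ?_
  filter_upwards [hZd] with h hh
  exact maurerCartan_cov hcov hh _

/-- All derivatives of the components of X, Y and Z cancel, so the curvature depends on values at g
alone. The hypothesis `hB` says that the left invariant connection has no torsion, and lets brackets
be replaced by commutators of B. -/
theorem maurerCartan_curvatureField [I.Boundaryless] [FiniteDimensional ℝ E]
    (hcov : ∀ (Y : Π g : G, TangentSpace I g) (g : G), MDiffAt (T% Y) g → ∀ v : TangentSpace I g,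
      cov Y g v = leftInvariantConnection B Y g v + p g v • Y g + p g (Y g) • v)
    (hB : ∀ x y, B x y - B y x = leftBracket I G x y)
    {g : G} (hp : MDifferentiableAt I (I.prod 𝓘(ℝ, E →L[ℝ] ℝ)) (fun x ↦ TotalSpace.mk' (E →L[ℝ] ℝ)
      (E := fun x : G ↦ TangentSpace I x →L[ℝ] Bundle.Trivial G ℝ x) x (p x)) g)
    {X Y Z : Π g : G, TangentSpace I g} (hX : MDiffAt (T% X) g) (hY : MDiffAt (T% Y) g)
    (hZ : ContMDiffAt I I.tangent 2 (T% Z) g) :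
    maurerCartan I g (cov.curvatureField X Y Z g) =
      leftCurvature B p g (maurerCartan I g (X g)) (maurerCartan I g (Y g))
        (maurerCartan I g (Z g)) := by
  have : CompleteSpace E := FiniteDimensional.complete ℝ E
  have : IsManifold I 2 G := IsManifold.of_le (n := ∞) ENat.LEInfty.out
  have hZd : ∀ᶠ y in nhds g, MDiffAt (T% Z) y := by
    filter_upwards [(contMDiffAt_iff_contMDiffAt_nhds (by simp)).1 hZ] with y hy
      using hy.mdifferentiableAt two_ne_zero
  have hz2 := contMDiffAt_maurerCartan hZ
  have hz := mdifferentiableAt_maurerCartan hZd.self_of_nhds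
  have hpZ := mdifferentiableAt_oneForm_apply hp hZd.self_of_nhds
  have hDD : ∀ {V W : Π x : G, TangentSpace I x}, MDiffAt (T% W) g →
      maurerCartan I g (cov (fun y ↦ cov Z y (W y)) g (V g)) =
        mvfderiv I (fun y ↦ mvfderiv I (fun h ↦ maurerCartan I h (Z h)) y (W y)) g (V g) +
        (B (mvfderiv I (fun h ↦ maurerCartan I h (W h)) g (V g)) (maurerCartan I g (Z g)) +
          B (maurerCartan I g (W g)) (mvfderiv I (fun h ↦ maurerCartan I h (Z h)) g (V g))) +
        (p g (W g) • mvfderiv I (fun h ↦ maurerCartan I h (Z h)) g (V g) +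
          mvfderiv I (fun y ↦ p y (W y)) g (V g) • maurerCartan I g (Z g)) +
        (p g (Z g) • mvfderiv I (fun h ↦ maurerCartan I h (W h)) g (V g) +
          mvfderiv I (fun y ↦ p y (Z y)) g (V g) • maurerCartan I g (W g)) +
        B (maurerCartan I g (V g)) (maurerCartan I g (cov Z g (W g))) +
        p g (V g) • maurerCartan I g (cov Z g (W g)) +
        p g (cov Z g (W g)) • maurerCartan I g (V g) := by
    intro V W hW
    have hw := mdifferentiableAt_maurerCartan hW
    have hpW := mdifferentiableAt_oneForm_apply hp hW
    have m1 := mdifferentiableAt_mvfderiv_apply hz2 hW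
    have m2 : MDifferentiableAt I 𝓘(ℝ, E) (fun h ↦ B (maurerCartan I h (W h)) (maurerCartan I h (Z h))) g :=
      (B.mdifferentiableAt.comp g hw).clm_apply hz
    have e1 := maurerCartan_cov hcov (mdifferentiableAt_cov hcov hp hW hZ) (V g)
    have e3 : (fun y ↦ maurerCartan I y (cov Z y (W y))) =ᶠ[nhds g]
        fun y ↦ (mvfderiv I (fun h ↦ maurerCartan I h (Z h)) y (W y) +
          B (maurerCartan I y (W y)) (maurerCartan I y (Z y))) +
          p y (W y) • maurerCartan I y (Z y) + p y (Z y) • maurerCartan I y (W y) := by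
      filter_upwards [hZd] with y hy using maurerCartan_cov hcov hy _
    have e4 := mvfderiv_congr_apply e3 (V g)
    have m3 : MDifferentiableAt I 𝓘(ℝ, E) (fun y ↦ mvfderiv I (fun h ↦ maurerCartan I h (Z h)) y (W y) +
          B (maurerCartan I y (W y)) (maurerCartan I y (Z y))) g := m1.add m2
    rw [e1, e4, mvfderiv_add_smul_add_smul m3 hpW hz hpZ hw, mvfderiv_add_apply m1 m2,
      mvfderiv_bilin_apply B hw hz]
  have e0 := mvfderiv_mlieBracket hz2 hX hY
  have e1 := hDD (V := X) hY
  have e2 := hDD (V := Y) hX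
  have e3 := maurerCartan_cov hcov hZd.self_of_nhds (VectorField.mlieBracket I X Y g)
  have c1 := maurerCartan_cov hcov hZd.self_of_nhds (X g)
  have c2 := maurerCartan_cov hcov hZd.self_of_nhds (Y g)
  have b0 := maurerCartan_mlieBracket hX hY
  -- Both projective terms contribute p(W)p(Z). This factor 2 turns the sign + of p(X)p(Z) in
  -- `schouten`, which refers to the changed connection, into the sign - in `leftSchouten`, which
  -- refers to B.
  have pc : ∀ W : Π g : G, TangentSpace I g, p g (cov Z g (W g)) =
      p g (leftTranslation I g (mvfderiv I (fun h ↦ maurerCartan I h (Z h)) g (W g))) +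
      p g (leftTranslation I g (B (maurerCartan I g (W g)) (maurerCartan I g (Z g)))) +
      2 * (p g (W g) * p g (Z g)) := by
    intro W
    rw [← leftTranslation_maurerCartan g (cov Z g (W g)), maurerCartan_cov hcov hZd.self_of_nhds]
    simp only [map_add, map_smul, leftTranslation_maurerCartan, smul_eq_mul]
    ring
  have pb : p g (VectorField.mlieBracket I X Y g) =
      p g (leftTranslation I g (mvfderiv I (fun h ↦ maurerCartan I h (Y h)) g (X g))) -
      p g (leftTranslation I g (mvfderiv I (fun h ↦ maurerCartan I h (X h)) g (Y g))) +
      p g (leftTranslation I g (leftBracket I G (maurerCartan I g (X g)) (maurerCartan I g (Y g)))) := by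
    rw [← leftTranslation_maurerCartan g (VectorField.mlieBracket I X Y g), b0, map_add, map_add,
      map_sub, map_sub]
  have d1 := mvfderiv_oneForm_apply hp hZd.self_of_nhds (X g)
  have d2 := mvfderiv_oneForm_apply hp hZd.self_of_nhds (Y g)
  have d3 := mvfderiv_oneForm_apply hp hX (Y g)
  have d4 := mvfderiv_oneForm_apply hp hY (X g)
  rw [LinearConnection.curvatureField, map_sub, map_sub, e1, e2, e3, c1, c2, b0, e0, pc, pc, pb,
    d1, d2, d3, d4, leftCurvature, leftExtDer, leftSchouten, leftSchouten, ← hB]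
  simp only [leftTranslation_maurerCartan, map_add, map_sub, map_smul, add_apply, sub_apply]
  module

end LieGroupCurvature

/-! ### The affine chart of PL(m) at the identity and its Lie bracket. -/

namespace PL

variable {m : ℕ} [NeZero m] {F : Type*} [NormedAddCommGroup F] [NormedSpace ℝ F]

theorem extChartAt_one_symm :
    ((extChartAt 𝓘(ℝ, SLAlg m) (1 : PL m)).symm : SLAlg m → PL m) =
      fun X ↦ ofMatrix (1 + mat X) := by
  funext X
  change (chart (1 : PL m)).symm X = _
  rw [chart_symm_apply, one_mul]

theorem extChartAt_one :
    (extChartAt 𝓘(ℝ, SLAlg m) (1 : PL m) : PL m → SLAlg m) = coordOne := by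
  funext q
  change chart (1 : PL m) q = _
  rw [chart_apply, inv_one, one_mul]

theorem coordOne_one : coordOne (1 : PL m) = 0 := by
  have := chart_self (1 : PL m)
  rwa [chart_apply, inv_one, one_mul] at this

/-- The tangent space at the identity is identified with `𝔰𝔩(m)` by the affine chart. -/
theorem mvfderiv_coordOne_one (v : TangentSpace 𝓘(ℝ, SLAlg m) (1 : PL m)) :
    mvfderiv 𝓘(ℝ, SLAlg m) coordOne (1 : PL m) v = v := by
  have : IsManifold 𝓘(ℝ, SLAlg m) 1 (PL m) := IsManifold.of_le (n := ∞) (by simp)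
  have h := mfderiv_chartAt_eq_tangentCoordChange (I := 𝓘(ℝ, SLAlg m))
    (mem_chart_source (SLAlg m) (1 : PL m))
  have h1 : (chartAt (SLAlg m) (1 : PL m) : PL m → SLAlg m) = coordOne := extChartAt_one
  rw [h1] at h
  exact (congrArg (fun L : SLAlg m →L[ℝ] SLAlg m ↦ L v) h).trans
    (tangentCoordChange_self (I := 𝓘(ℝ, SLAlg m)) (mem_extChartAt_source (1 : PL m)))

/-- The derivative of a function along a left invariant vector field. -/
theorem hasFDerivAt_mul_ofMatrix {f : PL m → F} {g : PL m}
    (hf : MDifferentiableAt 𝓘(ℝ, SLAlg m) 𝓘(ℝ, F) f g) :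
    HasFDerivAt (fun X : SLAlg m ↦ f (g * ofMatrix (1 + mat X)))
      ((mvfderiv 𝓘(ℝ, SLAlg m) f g : SLAlg m →L[ℝ] F) ∘L leftTranslation 𝓘(ℝ, SLAlg m) g) 0 := by
  have hf1 : MDifferentiableAt 𝓘(ℝ, SLAlg m) 𝓘(ℝ, F) f (g * 1) := by rwa [mul_one]
  have hl := mdifferentiable_leftMul (I := 𝓘(ℝ, SLAlg m)) g 1
  have h1 : MDifferentiableAt 𝓘(ℝ, SLAlg m) 𝓘(ℝ, F) (fun h ↦ f (g * h)) 1 := hf1.comp 1 hl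
  have hx := mem_extChartAt_source (I := 𝓘(ℝ, SLAlg m)) (1 : PL m)
  have hd : DifferentiableAt ℝ (fun X : SLAlg m ↦ f (g * ofMatrix (1 + mat X))) 0 := by
    have h2 : MDifferentiableAt 𝓘(ℝ, SLAlg m) 𝓘(ℝ, SLAlg m)
        (extChartAt 𝓘(ℝ, SLAlg m) (1 : PL m)).symm
        (extChartAt 𝓘(ℝ, SLAlg m) (1 : PL m) 1) :=
      ((contMDiffOn_extChartAt_symm (n := 1) (1 : PL m)).contMDiffAt
        ((isOpen_extChartAt_target (1 : PL m)).mem_nhds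
          ((extChartAt 𝓘(ℝ, SLAlg m) (1 : PL m)).map_source hx))).mdifferentiableAt one_ne_zero
    have h3 := MDifferentiableAt.comp (extChartAt 𝓘(ℝ, SLAlg m) (1 : PL m) 1)
      (g := fun h ↦ f (g * h)) (I' := 𝓘(ℝ, SLAlg m)) (by
        rwa [(extChartAt 𝓘(ℝ, SLAlg m) (1 : PL m)).left_inv hx]) h2
    rw [mdifferentiableAt_iff_differentiableAt, extChartAt_one_symm, extChartAt_one,
      coordOne_one] at h3
    exact h3
  refine hd.hasFDerivAt.congr_fderiv (ContinuousLinearMap.ext fun v ↦ ?_)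
  have h4 := mvfderiv_eq_fderiv_extChartAt hx h1 v
  rw [extChartAt_one_symm, extChartAt_one, coordOne_one] at h4
  refine ((h4.trans (congrArg _ (mvfderiv_coordOne_one v))).symm).trans ?_
  refine (mvfderiv_comp_mfderiv hf1 hl v).trans ?_
  have key : ∀ k : PL m, k = g → ∀ w : SLAlg m,
      (mvfderiv 𝓘(ℝ, SLAlg m) f k : SLAlg m →L[ℝ] F) w = mvfderiv 𝓘(ℝ, SLAlg m) f g w := by
    rintro k rfl w; rfl
  exact key _ (mul_one g) _

theorem hasDerivAt_mul_ofMatrix {f : PL m → F} {g : PL m}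
    (hf : MDifferentiableAt 𝓘(ℝ, SLAlg m) 𝓘(ℝ, F) f g) (v : SLAlg m) :
    HasDerivAt (fun t : ℝ ↦ f (g * ofMatrix (1 + t • mat v)))
      (mvfderiv 𝓘(ℝ, SLAlg m) f g (leftTranslation 𝓘(ℝ, SLAlg m) g v)) 0 := by
  have h1 : HasDerivAt (fun t : ℝ ↦ t • v) v 0 := by
    simpa using (hasDerivAt_id (0 : ℝ)).smul_const v
  have h2 := hasFDerivAt_mul_ofMatrix hf
  rw [← zero_smul ℝ v] at h2
  have h3 := h2.comp_hasDerivAt (0 : ℝ) h1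
  simpa [Function.comp_def] using h3

/-- The bilinear map defining `∇_m`. -/
def bilin (m : ℕ) [NeZero m] : SLAlg m →L[ℝ] SLAlg m →L[ℝ] SLAlg m :=
  LinearMap.toContinuousBilinearMap
    ((LinearMap.mul ℝ (Matrix (Fin m) (Fin m) ℝ)).compl₁₂ mat mat |>.compr₂ (slPart m))

theorem bilin_apply (X Y : SLAlg m) : bilin m X Y = slPart m (mat X * mat Y) := rfl

theorem slPart_mat (X : SLAlg m) : slPart m (mat X) = X := by
  apply SLAlg.mat_injective
  rw [mat_slPart, SLAlg.trace_mat]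
  simp

theorem slPart_one_add_mat (X : SLAlg m) : slPart m (1 + mat X) = X := by
  rw [map_add, slPart_mat]
  convert zero_add X
  apply SLAlg.mat_injective
  rw [mat_slPart]
  simp [NeZero.ne]

/-- The left invariant vector fields in the affine chart. -/
theorem mvfderiv_coordOne {g : PL m} (hg : g ∈ coordSource m) (X : SLAlg m) :
    mvfderiv 𝓘(ℝ, SLAlg m) coordOne g (leftTranslation 𝓘(ℝ, SLAlg m) g X) =
      slPart m ((1 + mat (coordOne g)) * mat X) -
        ((mat (coordOne g) * mat X).trace / m) • coordOne g := by
  have hm : (m : ℝ) ≠ 0 := NeZero.ne _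
  have hd : MDifferentiableAt 𝓘(ℝ, SLAlg m) 𝓘(ℝ, SLAlg m) (coordOne : PL m → SLAlg m) g := by
    rw [← extChartAt_one]
    apply mdifferentiableAt_extChartAt
    change 1⁻¹ * g ∈ coordSource m
    simpa using hg
  refine (hasDerivAt_mul_ofMatrix hd X).unique ?_
  set A := mat (coordOne g) with hA
  have hgA : g = ofMatrix (1 + A) ∧ (1 + A).det ≠ 0 := by
    refine ⟨((chartOne m).left_inv hg).symm, (chartOne m).map_source hg⟩
  have htA : (1 + A).trace = m := by
    rw [Matrix.trace_add, hA, SLAlg.trace_mat]; simp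
  have htAX : ((1 + A) * mat X).trace = (A * mat X).trace := by
    rw [add_mul, one_mul, Matrix.trace_add, SLAlg.trace_mat, zero_add]
  -- With A and X trace-free, (1 + A)(1 + tX) has trace m + t tr(AX). The chart divides by this
  -- trace; differentiating the normalising factor gives the scalar multiple of `coordOne g` in the
  -- formula.
  have h1 : HasDerivAt (fun t : ℝ ↦ (m : ℝ) + t * (A * mat X).trace) (A * mat X).trace 0 := by
    simpa using ((hasDerivAt_id (0 : ℝ)).mul_const (A * mat X).trace).const_add (m : ℝ)
  have h2 : HasDerivAt (fun t : ℝ ↦ (m : ℝ) / ((m : ℝ) + t * (A * mat X).trace))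
      (-((A * mat X).trace / m)) 0 := by
    have := (hasDerivAt_const (0 : ℝ) (m : ℝ)).div h1 (by simpa using hm)
    refine this.congr_deriv ?_
    rw [zero_mul, zero_mul, add_zero, zero_sub]
    field_simp
  have h3 : HasDerivAt (fun t : ℝ ↦ coordOne g + t • slPart m ((1 + A) * mat X))
      (slPart m ((1 + A) * mat X)) 0 := by
    simpa using ((hasDerivAt_id (0 : ℝ)).smul_const (slPart m ((1 + A) * mat X))).const_add
      (coordOne g)
  have h4 := h2.smul h3
  have h5 : ∀ᶠ t : ℝ in nhds 0, (1 + t • mat X).det ≠ 0 := by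
    have hc : Continuous fun t : ℝ ↦ (1 + t • mat X).det := by fun_prop
    refine hc.continuousAt.eventually_ne ?_
    simp
  convert h4.congr_of_eventuallyEq (f₁ := fun t : ℝ ↦ coordOne (g * ofMatrix (1 + t • mat X))) ?_
    using 1
  · simp [hm, sub_eq_add_neg]
  · filter_upwards [h5] with t ht
    have hdet : ((1 + A) * (1 + t • mat X)).det ≠ 0 := by
      rw [Matrix.det_mul]; exact mul_ne_zero hgA.2 ht
    have htr : ((1 + A) * (1 + t • mat X)).trace = m + t * (A * mat X).trace := by
      rw [mul_add, mul_one, Matrix.trace_add, htA, Matrix.mul_smul, Matrix.trace_smul, htAX,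
        smul_eq_mul]
    rw [hgA.1, ← ofMatrix_mul hgA.2 ht, coordOne_ofMatrix hdet, htr, map_smul]
    simp only [Pi.smul_apply']
    congr 1
    rw [mul_add, mul_one, map_add, hA, slPart_one_add_mat, Matrix.mul_smul, map_smul]
    congr 1
    rw [coordOne_ofMatrix hgA.2, htA, div_self hm, one_smul, hA, slPart_one_add_mat]

/-- The affine coordinate has the identity as its derivative at 1, so the bracket can be read off in
it: the field of Y, differentiated at 1 along X, gives the trace-free part of XY. This is the
vanishing of the torsion of ∇_m. -/
theorem leftBracket_eq (X Y : SLAlg m) :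
    leftBracket 𝓘(ℝ, SLAlg m) (PL m) X Y = bilin m X Y - bilin m Y X := by
  have : CompleteSpace (SLAlg m) := FiniteDimensional.complete ℝ _
  have : IsManifold 𝓘(ℝ, SLAlg m) 2 (PL m) := IsManifold.of_le (n := ∞) ENat.LEInfty.out
  have hf : ContMDiffAt 𝓘(ℝ, SLAlg m) 𝓘(ℝ, SLAlg m) 2 (coordOne : PL m → SLAlg m) 1 := by
    rw [← extChartAt_one]
    exact contMDiffAt_extChartAt
  have h := mvfderiv_mlieBracket hf (mdifferentiableAt_leftTranslation X 1)
    (mdifferentiableAt_leftTranslation Y 1)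
  have hone : ∀ v : TangentSpace 𝓘(ℝ, SLAlg m) (1 : PL m),
      mvfderiv 𝓘(ℝ, SLAlg m) coordOne (1 : PL m) v = v :=
    mvfderiv_coordOne_one
  have hL : ∀ v : SLAlg m, leftTranslation 𝓘(ℝ, SLAlg m) (1 : PL m) v = v := by
    intro v
    have h1 : (fun h : PL m ↦ 1 * h) = id := by funext h; simp
    have h2 : (leftTranslation 𝓘(ℝ, SLAlg m) (1 : PL m) : SLAlg m →L[ℝ] SLAlg m) =
        mfderiv 𝓘(ℝ, SLAlg m) 𝓘(ℝ, SLAlg m) (id : PL m → PL m) 1 := by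
      rw [← h1]; rfl
    rw [mfderiv_id] at h2
    exact congrArg (fun L : SLAlg m →L[ℝ] SLAlg m ↦ L v) h2
  have hD : ∀ X Y : SLAlg m, mvfderiv 𝓘(ℝ, SLAlg m) (fun g : PL m ↦
      mvfderiv 𝓘(ℝ, SLAlg m) coordOne g (leftTranslation 𝓘(ℝ, SLAlg m) g Y)) 1
        (leftTranslation 𝓘(ℝ, SLAlg m) 1 X) = bilin m X Y := by
    intro X Y
    have e1 : (fun g : PL m ↦ mvfderiv 𝓘(ℝ, SLAlg m) coordOne g
        (leftTranslation 𝓘(ℝ, SLAlg m) g Y)) =ᶠ[nhds 1]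
        fun g ↦ (fun A ↦ slPart m ((1 + mat A) * mat Y) -
        ((mat A * mat Y).trace / (m : ℝ)) • A) (coordOne g) := by
      filter_upwards [(chartOne m).open_source.mem_nhds one_mem_coordSource] with g hg
      exact mvfderiv_coordOne hg Y
    -- The trace correction is quadratic in A, so it contributes nothing to the derivative at A = 0.
    have e2 : HasFDerivAt (fun A : SLAlg m ↦ slPart m ((1 + mat A) * mat Y) -
        ((mat A * mat Y).trace / (m : ℝ)) • A) ((bilin m).flip Y) 0 := by
      let τ : SLAlg m →L[ℝ] ℝ := LinearMap.toContinuousLinearMap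
        ((Matrix.traceLinearMap (Fin m) ℝ ℝ) ∘ₗ (LinearMap.mulRight ℝ (mat Y)) ∘ₗ mat)
      have e3 : (fun A : SLAlg m ↦ slPart m ((1 + mat A) * mat Y) -
        ((mat A * mat Y).trace / (m : ℝ)) • A) = fun A ↦ (Y + (bilin m).flip Y A) -
          ((m : ℝ)⁻¹ • τ A) • A := by
        funext A
        rw [add_mul, one_mul, map_add, slPart_mat, div_eq_inv_mul]
        rfl
      rw [e3]
      have e4 := (((bilin m).flip Y).hasFDerivAt (x := (0 : SLAlg m))).const_add Y
      have e5 := (((τ.hasFDerivAt (x := (0 : SLAlg m))).const_smul (m : ℝ)⁻¹).smul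
        (hasFDerivAt_id (0 : SLAlg m)))
      refine (e4.sub e5).congr_fderiv ?_
      ext A
      simp
    rw [← coordOne_one] at e2
    refine (mvfderiv_congr_apply e1 _).trans ?_
    refine (mvfderiv_fderiv_comp (f := coordOne) e2.differentiableAt
      (hf.mdifferentiableAt two_ne_zero) _).trans ?_
    rw [e2.fderiv, hL]
    exact congrArg ((bilin m).flip Y) (hone X)
  rw [hone, hD, hD] at h
  exact h

end PL

/-! ### The Ricci tensor of a projective change of ∇_m. -/

/-- A solution of `u' = u ^ 2` on the whole real line vanishes. -/
theorem eq_zero_of_hasDerivAt_sq {u : ℝ → ℝ} (hu : ∀ t, HasDerivAt u (u t ^ 2) t) : u 0 = 0 := by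
  by_contra hc
  have hcont : Continuous u := continuous_iff_continuousAt.2 fun t ↦ (hu t).continuousAt
  have hU : ∀ t, HasDerivAt (fun t ↦ ∫ s in (0 : ℝ)..t, u s) (u t) t := fun t ↦
    intervalIntegral.integral_hasDerivAt_right (hcont.intervalIntegrable _ _)
      (hcont.stronglyMeasurableAtFilter _ _) hcont.continuousAt
  -- The solution should be u(0)/(1 - u(0)t). The defect u(t)(1 - u(0)t) - u(0) satisfies the linear
  -- equation f' = u f, so multiplying it by exp(-∫u) gives a constant, which is 0 at t = 0.
  have hf : ∀ t, HasDerivAt (fun t ↦ (u t * (1 - u 0 * t) - u 0) *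
      Real.exp (-∫ s in (0 : ℝ)..t, u s)) 0 t := by
    intro t
    have h1 : HasDerivAt (fun t ↦ 1 - u 0 * t) (-u 0) t := by
      simpa using ((hasDerivAt_id t).const_mul (u 0)).const_sub 1
    refine ((((hu t).mul h1).sub_const (u 0)).mul (hU t).neg.exp).congr_deriv ?_
    simp only [Pi.neg_apply, Pi.mul_apply]
    ring
  -- At the expected blow-up time 1/u(0) the defect equals -u(0), which contradicts its vanishing.
  have h := is_const_of_deriv_eq_zero (fun t ↦ (hf t).differentiableAt) (fun t ↦ (hf t).deriv)
    (u 0)⁻¹ 0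
  simp only [mul_inv_cancel₀ hc] at h
  simp [hc] at h

/-- The trace of `x ↦ ℓ(x) w - ℓ(w) x`. -/
theorem sum_coord_smul_sub_smul {V ι : Type*} [AddCommGroup V] [Module ℝ V] [Fintype ι]
    (b : Module.Basis ι ℝ V) (ℓ : V →ₗ[ℝ] ℝ) (w : V) :
    ∑ i, b.coord i (ℓ (b i) • w - ℓ w • b i) = (1 - Fintype.card ι) * ℓ w := by
  have h : ℓ w = ∑ i, ℓ (b i) * b.coord i w := by
    conv_lhs => rw [← b.sum_repr w]
    simp only [map_sum, map_smul, smul_eq_mul, mul_comm, Module.Basis.coord_apply]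
  simp only [map_sub, map_smul, smul_eq_mul, Finset.sum_sub_distrib, ← h]
  simp [sub_mul]

namespace PL

variable {m : ℕ} [NeZero m]

theorem finrank_SLAlg (m : ℕ) [NeZero m] : Module.finrank ℝ (SLAlg m) + 1 = m * m := by
  have h := LinearMap.finrank_range_add_finrank_ker (Matrix.traceLinearMap (Fin m) ℝ ℝ)
  have h1 : LinearMap.range (Matrix.traceLinearMap (Fin m) ℝ ℝ) = ⊤ := by
    rw [LinearMap.range_eq_top]
    intro r
    refine ⟨Matrix.single 0 0 r, ?_⟩
    simp
  rw [h1, finrank_top, Module.finrank_self, Module.finrank_matrix] at h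
  simp only [Fintype.card_fin, Module.finrank_self, mul_one] at h
  rw [← h, add_comm]
  rfl

/-- A linear form on `𝔰𝔩(m)` that vanishes on matrices of square zero vanishes. -/
theorem linearMap_eq_zero_of_sq_zero (q : SLAlg m →ₗ[ℝ] ℝ)
    (hq : ∀ X : SLAlg m, mat X * mat X = 0 → q X = 0) : q = 0 := by
  -- Extending q by the trace-free part allows it to be evaluated on the single matrix units E_ii,
  -- which have nonzero trace.
  let Q : Matrix (Fin m) (Fin m) ℝ →ₗ[ℝ] ℝ := q ∘ₗ slPart m
  have hQ : ∀ A : Matrix (Fin m) (Fin m) ℝ, A.trace = 0 → A * A = 0 → Q A = 0 := by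
    intro A hA hAA
    refine hq _ ?_
    rw [mat_slPart, hA]
    simpa using hAA
  have h1 : ∀ i j : Fin m, i ≠ j → Q (Matrix.single i j 1) = 0 := fun i j hij ↦
    hQ _ (Matrix.trace_single_eq_of_ne i j _ hij) (by simp [hij.symm])
  have h2 : ∀ i : Fin m, Q (Matrix.single i i 1) = Q (Matrix.single 0 0 1) := by
    intro i
    by_cases hi : i = 0
    · rw [hi]
    -- In the plane of indices 0 and i this is the trace-free matrix with rows (-1, 1) and (-1, 1),
    -- of square zero; since Q kills its off-diagonal part, it compares E_ii with E_00.
    have h3 := hQ (Matrix.single i i 1 - Matrix.single i 0 1 + Matrix.single 0 i 1 -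
      Matrix.single 0 0 1) (by simp [Matrix.trace_sub, Matrix.trace_add,
        Matrix.trace_single_eq_of_ne _ _ _ hi, Matrix.trace_single_eq_of_ne _ _ _ (Ne.symm hi)])
        (by
          simp only [mul_sub, mul_add, sub_mul, add_mul, Matrix.single_mul_single_same,
            Matrix.single_mul_single_of_ne _ _ _ _ hi,
            Matrix.single_mul_single_of_ne _ _ _ _ (Ne.symm hi), mul_one]
          abel)
    rw [map_sub, map_add, map_sub, h1 _ _ hi, h1 _ _ (Ne.symm hi)] at h3
    linarith
  ext X
  have h4 : q X = Q (mat X) := by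
    change _ = q (slPart m (mat X))
    rw [slPart_mat]
  rw [h4, Matrix.matrix_eq_sum_single (mat X), map_sum]
  have h5 : ∀ i : Fin m, Q (∑ j, Matrix.single i j (mat X i j)) =
      mat X i i * Q (Matrix.single 0 0 1) := by
    intro i
    rw [map_sum, Finset.sum_eq_single i]
    · rw [← h2 i, ← smul_eq_mul, ← map_smul, Matrix.smul_single, smul_eq_mul, mul_one]
    · intro j _ hj
      have : Matrix.single i j (mat X i j) = mat X i j • Matrix.single i j (1 : ℝ) := by
        rw [Matrix.smul_single, smul_eq_mul, mul_one]
      rw [this, map_smul, h1 i j hj.symm, smul_zero]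
    · simp
  simp only [h5]
  rw [← Finset.sum_mul]
  have h6 : ∑ i, mat X i i = 0 := SLAlg.trace_mat X
  rw [h6, zero_mul]
  rfl

/-- The algebraic part of the curvature of `∇_m`. -/
theorem bilin_bilin_sub (x y z : SLAlg m) :
    bilin m x (bilin m y z) - bilin m y (bilin m x z) -
        bilin m (bilin m x y - bilin m y x) z =
      ((mat x * mat z).trace / m) • y - ((mat y * mat z).trace / m) • x := by
  have h : ∀ x y z : SLAlg m, bilin m x (bilin m y z) =
      slPart m (mat x * mat y * mat z) - ((mat y * mat z).trace / m) • x := by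
    intro x y z
    rw [bilin_apply, bilin_apply, mat_slPart, mul_sub, map_sub, Matrix.mul_smul, mul_one,
      map_smul, slPart_mat, mul_assoc]
  -- The scalar parts removed from xy and yx agree because tr(xy) = tr(yx), so the commutator needs
  -- no trace correction.
  have h1 : bilin m (bilin m x y - bilin m y x) z =
      slPart m (mat x * mat y * mat z) - slPart m (mat y * mat x * mat z) := by
    rw [bilin_apply, map_sub, bilin_apply, bilin_apply, mat_slPart, mat_slPart,
      Matrix.trace_mul_comm, sub_sub_sub_cancel_right, sub_mul, map_sub]
  rw [h, h, h1]
  abel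

variable {p : Π g : PL m, TangentSpace 𝓘(ℝ, SLAlg m) g →L[ℝ] ℝ}

/-- Setting the last two arguments equal makes every curvature term a multiple of y or of x, with
coefficients from one linear form, so the trace over x is immediate. The exterior derivative drops
out of ℓ(y) because it is alternating. -/
theorem exists_leftCurvature_eq {g : PL m}
    (hp : MDifferentiableAt 𝓘(ℝ, SLAlg m) (𝓘(ℝ, SLAlg m).prod 𝓘(ℝ, SLAlg m →L[ℝ] ℝ))
      (fun x ↦ TotalSpace.mk' (SLAlg m →L[ℝ] ℝ)
        (E := fun x : PL m ↦ TangentSpace 𝓘(ℝ, SLAlg m) x →L[ℝ] Bundle.Trivial (PL m) ℝ x)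
        x (p x)) g) (y : SLAlg m) :
    ∃ ℓ : SLAlg m →ₗ[ℝ] ℝ,
      ℓ y = (mat y * mat y).trace / m + leftSchouten (bilin m) p g y y ∧
      ∀ x, leftCurvature (bilin m) p g x y y = ℓ x • y - ℓ y • x := by
  have hd := fun v ↦ mdifferentiableAt_oneForm_apply hp (mdifferentiableAt_leftTranslation v g)
  have hadd : ∀ (v w : SLAlg m) (u : TangentSpace 𝓘(ℝ, SLAlg m) g),
      mvfderiv 𝓘(ℝ, SLAlg m) (fun h ↦ p h (leftTranslation 𝓘(ℝ, SLAlg m) h (v + w))) g u =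
      mvfderiv 𝓘(ℝ, SLAlg m) (fun h ↦ p h (leftTranslation 𝓘(ℝ, SLAlg m) h v)) g u +
      mvfderiv 𝓘(ℝ, SLAlg m) (fun h ↦ p h (leftTranslation 𝓘(ℝ, SLAlg m) h w)) g u := by
    intro v w u
    simp only [map_add]
    exact mvfderiv_add_apply (hd v) (hd w) u
  have hsmul : ∀ (c : ℝ) (v : SLAlg m) (u : TangentSpace 𝓘(ℝ, SLAlg m) g),
      mvfderiv 𝓘(ℝ, SLAlg m) (fun h ↦ p h (leftTranslation 𝓘(ℝ, SLAlg m) h (c • v))) g u =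
      c * mvfderiv 𝓘(ℝ, SLAlg m) (fun h ↦ p h (leftTranslation 𝓘(ℝ, SLAlg m) h v)) g u := by
    intro c v u
    simp only [map_smul, smul_eq_mul]
    have := mvfderiv_bilin_apply (I := 𝓘(ℝ, SLAlg m)) (ContinuousLinearMap.mul ℝ ℝ)
      (mdifferentiableAt_const (c := c)) (hd v) u
    refine this.trans ?_
    rw [mvfderiv_const]
    simp
  let ℓ : SLAlg m →ₗ[ℝ] ℝ :=
    { toFun := fun x ↦ (mat x * mat y).trace / m + leftExtDer p g x y +
        leftSchouten (bilin m) p g x y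
      map_add' := by
        intro a b
        simp only [leftExtDer, leftSchouten, leftBracket_eq, hadd]
        simp only [map_add, add_mul, Matrix.trace_add, map_sub, add_apply]
        ring
      map_smul' := by
        intro c a
        simp only [leftExtDer, leftSchouten, leftBracket_eq, hsmul]
        simp only [map_smul, Matrix.smul_mul, Matrix.trace_smul, map_sub, smul_apply, smul_eq_mul, RingHom.id_apply]
        ring }
  have hℓ : ∀ x, ℓ x = (mat x * mat y).trace / m + leftExtDer p g x y +
        leftSchouten (bilin m) p g x y := fun _ ↦ rfl
  have h0 : leftExtDer p g y y = 0 := by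
    simp [leftExtDer, leftBracket_eq]
  refine ⟨ℓ, by rw [hℓ, h0, add_zero], fun x ↦ ?_⟩
  rw [leftCurvature, leftBracket_eq, bilin_bilin_sub, hℓ, hℓ, h0]
  module

/-- No 1-form on `PL(m)` satisfies the vanishing condition for the Ricci tensor. -/
theorem exists_trace_add_leftSchouten_ne_zero (hm : 2 ≤ m)
    (hp : ∀ g, MDifferentiableAt 𝓘(ℝ, SLAlg m) (𝓘(ℝ, SLAlg m).prod 𝓘(ℝ, SLAlg m →L[ℝ] ℝ))
      (fun x ↦ TotalSpace.mk' (SLAlg m →L[ℝ] ℝ)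
        (E := fun x : PL m ↦ TangentSpace 𝓘(ℝ, SLAlg m) x →L[ℝ] Bundle.Trivial (PL m) ℝ x)
        x (p x)) g) :
    ∃ (g : PL m) (y : SLAlg m),
      (mat y * mat y).trace / m + leftSchouten (bilin m) p g y y ≠ 0 := by
  by_contra! h
  -- For X of square zero, 1 + tX is invertible for every t, so the integral curve stays in PL(m)
  -- for all time, and p(X) along it solves u' = u².
  have h1 : ∀ (g : PL m) (X : SLAlg m), mat X * mat X = 0 →
      p g (leftTranslation 𝓘(ℝ, SLAlg m) g X) = 0 := by
    intro g X hX
    have hdet : ∀ t : ℝ, (1 + t • mat X).det ≠ 0 := by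
      intro t ht
      have h2 : (1 + t • mat X) * (1 - t • mat X) = 1 := by
        simp [add_mul, mul_sub, hX]
      have h3 := congrArg Matrix.det h2
      rw [Matrix.det_mul, ht, zero_mul, Matrix.det_one] at h3
      exact zero_ne_one h3
    have hB : bilin m X X = 0 := by rw [bilin_apply, hX, map_zero]
    have h4 := eq_zero_of_hasDerivAt_sq (u := fun t ↦ p (g * ofMatrix (1 + t • mat X))
      (leftTranslation 𝓘(ℝ, SLAlg m) (g * ofMatrix (1 + t • mat X)) X)) fun t ↦ by
        have h5 := hasDerivAt_mul_ofMatrix (mdifferentiableAt_oneForm_apply (hp _)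
          (mdifferentiableAt_leftTranslation X (g * ofMatrix (1 + t • mat X)))) X
        have h6 := h (g * ofMatrix (1 + t • mat X)) X
        rw [hX, leftSchouten, hB] at h6
        simp only [Matrix.trace_zero, zero_div, map_zero, sub_zero, zero_add] at h6
        rw [sub_eq_zero.1 h6] at h5
        -- Since (1 + tX)(1 + sX) = 1 + (t + s)X, differentiating at s = 0 from the point at time t
        -- gives the derivative of u at t.
        have h7 : (fun s : ℝ ↦ p (g * ofMatrix (1 + t • mat X) * ofMatrix (1 + s • mat X))
            (leftTranslation 𝓘(ℝ, SLAlg m)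
              (g * ofMatrix (1 + t • mat X) * ofMatrix (1 + s • mat X)) X)) =
            fun s ↦ (fun t ↦ p (g * ofMatrix (1 + t • mat X))
              (leftTranslation 𝓘(ℝ, SLAlg m) (g * ofMatrix (1 + t • mat X)) X)) (t + s) := by
          funext s
          have : g * ofMatrix (1 + t • mat X) * ofMatrix (1 + s • mat X) =
              g * ofMatrix (1 + (t + s) • mat X) := by
            rw [mul_assoc, ← ofMatrix_mul (hdet t) (hdet s)]
            congr 2
            simp [add_mul, mul_add, hX, add_smul]
            abel
          rw [this]
        rw [h7, ← sq] at h5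
        rw [← sub_self t] at h5
        refine (h5.comp_sub_const t t).congr_of_eventuallyEq (Filter.Eventually.of_forall fun s ↦ ?_)
        exact congrArg (fun t ↦ p (g * ofMatrix (1 + t • mat X))
          (leftTranslation 𝓘(ℝ, SLAlg m) (g * ofMatrix (1 + t • mat X)) X)) (add_sub_cancel t s).symm
    have h9 : g * ofMatrix (1 + (0 : ℝ) • mat X) = g := by
      rw [zero_smul, add_zero, ofMatrix_one, mul_one]
    beta_reduce at h4
    rwa [h9] at h4
  have h2 : ∀ (g : PL m) (X : SLAlg m), p g (leftTranslation 𝓘(ℝ, SLAlg m) g X) = 0 := by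
    intro g X
    have := linearMap_eq_zero_of_sq_zero
      ((p g).toLinearMap ∘ₗ (leftTranslation 𝓘(ℝ, SLAlg m) g).toLinearMap) (h1 g)
    exact congrArg (fun L : SLAlg m →ₗ[ℝ] ℝ ↦ L X) this
  -- Once p vanishes identically, so does every term of `leftSchouten`, and the trace form is all
  -- that is left.
  have h3 : ∀ y : SLAlg m, (mat y * mat y).trace = 0 := by
    intro y
    have h4 := h 1 y
    have hm0 : (m : ℝ) ≠ 0 := NeZero.ne _
    simpa [leftSchouten, h2, mvfderiv_const, hm0] using h4
  -- Two distinct indices exist because m ≥ 2; the matrix E_ii - E_jj is trace-free and its square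
  -- has trace 2.
  let i : Fin m := ⟨0, by omega⟩
  let j : Fin m := ⟨1, by omega⟩
  have hij : i ≠ j := by simp [i, j]
  have h5 := h3 (slPart m (Matrix.single i i 1 - Matrix.single j j 1))
  rw [mat_slPart] at h5
  simp [mul_sub, sub_mul, hij, hij.symm, Matrix.trace_sub] at h5

end PL

/-! ### From curvature in the frame to the curvature and Ricci tensors. -/

section

variable {E : Type*} [NormedAddCommGroup E] [NormedSpace ℝ E] {H : Type*} [TopologicalSpace H]
  {I : ModelWithCorners ℝ E H}

theorem IsSmoothOneFormOn.mdifferentiableAt {M : Type*} [TopologicalSpace M] [ChartedSpace H M]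
    [IsManifold I 1 M] {p : Π x : M, TangentSpace I x →L[ℝ] ℝ} {s : Set M}
    (hp : IsSmoothOneFormOn p s) {x : M} (hs : s ∈ nhds x) :
    MDifferentiableAt I (I.prod 𝓘(ℝ, E →L[ℝ] ℝ)) (fun x ↦ TotalSpace.mk' (E →L[ℝ] ℝ)
      (E := fun x : M ↦ TangentSpace I x →L[ℝ] Bundle.Trivial M ℝ x) x (p x)) x :=
  (ContMDiffOn.contMDiffAt hp hs).mdifferentiableAt (by simp)

variable {G : Type*} [TopologicalSpace G] [ChartedSpace H G] [Group G] [LieGroup I ∞ G]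
  [IsManifold I 1 G] {cov : LinearConnection I G} {B : E →L[ℝ] E →L[ℝ] E}
  {p : Π g : G, TangentSpace I g →L[ℝ] ℝ}

/-- The curvature tensor is computed with chosen extensions of the three vectors. They are smooth
enough for the frame formula, which sees only their values at g. -/
theorem curvature_eq_leftTranslation [I.Boundaryless] [FiniteDimensional ℝ E]
    (hcov : ∀ (Y : Π g : G, TangentSpace I g) (g : G), MDiffAt (T% Y) g → ∀ v : TangentSpace I g,
      cov Y g v = leftInvariantConnection B Y g v + p g v • Y g + p g (Y g) • v)
    (hB : ∀ x y, B x y - B y x = leftBracket I G x y)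
    {g : G} (hp : MDifferentiableAt I (I.prod 𝓘(ℝ, E →L[ℝ] ℝ)) (fun x ↦ TotalSpace.mk' (E →L[ℝ] ℝ)
      (E := fun x : G ↦ TangentSpace I x →L[ℝ] Bundle.Trivial G ℝ x) x (p x)) g)
    (u v w : TangentSpace I g) :
    cov.curvature g u v w = leftTranslation I g (leftCurvature B p g (maurerCartan I g u)
      (maurerCartan I g v) (maurerCartan I g w)) := by
  have : IsManifold I (2 + 1) G := IsManifold.of_le (n := ∞) (by norm_num; exact ENat.LEInfty.out)
  have hC : ContMDiffAt I I.tangent 2 (T% (FiberBundle.extend E w)) g :=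
    FiberBundle.contMDiffAt_extend I E w
  have h := maurerCartan_curvatureField hcov hB hp
    (FiberBundle.mdifferentiableAt_extend I E u) (FiberBundle.mdifferentiableAt_extend I E v) hC
  simp only [FiberBundle.extend_apply_self] at h
  rw [← h, leftTranslation_maurerCartan]
  rfl

end

namespace PL

variable {m : ℕ} [NeZero m] {cov' : LinearConnection 𝓘(ℝ, SLAlg m) (PL m)}

/-- Tracing the form ℓ(x)y - ℓ(y)x gives 1 - dim times ℓ(y), and some g and y have ℓ(y) ≠ 0. -/
theorem exists_ricci_ne_zero (hm : 2 ≤ m) (hcov' : (nablaPL m).IsProjectivelyEquivalent cov') :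
    ∃ (g : PL m) (v w : TangentSpace 𝓘(ℝ, SLAlg m) g), cov'.ricci g v w ≠ 0 := by
  obtain ⟨p, hp, hcov⟩ := hcov'
  have hp' := fun g ↦ hp.mdifferentiableAt (x := g) Filter.univ_mem
  obtain ⟨g, y, h⟩ := exists_trace_add_leftSchouten_ne_zero hm hp'
  obtain ⟨ℓ, hℓ, hℓ'⟩ := exists_leftCurvature_eq (hp' g) y
  let w : SLAlg m := leftTranslation 𝓘(ℝ, SLAlg m) g y
  let ℓw : SLAlg m →ₗ[ℝ] ℝ := ℓ ∘ₗ (maurerCartan 𝓘(ℝ, SLAlg m) g : SLAlg m →L[ℝ] SLAlg m).toLinearMap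
  have hw : ℓw w = ℓ y := congrArg ℓ (maurerCartan_leftTranslation g y)
  refine ⟨g, w, w, ?_⟩
  have h1 : ∀ u : TangentSpace 𝓘(ℝ, SLAlg m) g, cov'.curvature g u w w =
      ℓ (maurerCartan 𝓘(ℝ, SLAlg m) g u) • leftTranslation 𝓘(ℝ, SLAlg m) g y - ℓ y • u := by
    intro u
    have e1 := curvature_eq_leftTranslation hcov (fun x y ↦ (leftBracket_eq x y).symm) (hp' g) u w w
    have e2 : maurerCartan 𝓘(ℝ, SLAlg m) g w = y := maurerCartan_leftTranslation g y
    refine e1.trans ?_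
    rw [e2]
    refine (congrArg _ (hℓ' _)).trans ?_
    rw [map_sub, map_smul, map_smul, leftTranslation_maurerCartan]
  have h2 : cov'.ricci g w w = (1 - Module.finrank ℝ (SLAlg m)) * ℓw w := by
    rw [LinearConnection.ricci]
    refine Eq.trans ?_ ((sum_coord_smul_sub_smul (Module.finBasis ℝ (SLAlg m)) ℓw w).trans ?_)
    · rw [hw]
      exact Finset.sum_congr rfl fun i _ ↦ congrArg _ (h1 _)
    · rw [Fintype.card_fin]
  rw [h2, hw, hℓ]
  -- The factor 1 - dim is nonzero: dimension 1 would force m² = 2, while m ≥ 2.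
  refine mul_ne_zero ?_ h
  intro h3
  have h4 : Module.finrank ℝ (SLAlg m) = 1 := by
    have : (Module.finrank ℝ (SLAlg m) : ℝ) = 1 := by linarith
    exact_mod_cast this
  have h5 := finrank_SLAlg m
  nlinarith

theorem ricci_eq_zero_of_curvature_eq_zero
    (h : ∀ (g : PL m) (u v w : TangentSpace 𝓘(ℝ, SLAlg m) g), cov'.curvature g u v w = 0)
    (g : PL m) (v w : TangentSpace 𝓘(ℝ, SLAlg m) g) : cov'.ricci g v w = 0 := by
  rw [LinearConnection.ricci]
  refine Finset.sum_eq_zero fun i _ ↦ (congrArg _ (h g _ v w)).trans ?_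
  exact map_zero ((Module.finBasis ℝ (SLAlg m)).coord i)

end PL

/-! ### Product connections and their projective flatness. -/

section ProductConnection

variable {E : Type*} [NormedAddCommGroup E] [NormedSpace ℝ E] {H : Type*} [TopologicalSpace H]
  {I : ModelWithCorners ℝ E H} {M : Type*} [TopologicalSpace M] [ChartedSpace H M]
  {E' : Type*} [NormedAddCommGroup E'] [NormedSpace ℝ E'] {H' : Type*} [TopologicalSpace H']
  {I' : ModelWithCorners ℝ E' H'} {M' : Type*} [TopologicalSpace M'] [ChartedSpace H' M']

/-- The derivative of the inverse map is a left inverse. Injectivity allows the curvature identity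
to be pulled back from the flat chart to tangent vectors. -/
theorem mfderiv_injective_of_openPartialHomeomorph {F : Type*} [NormedAddCommGroup F]
    [NormedSpace ℝ F] (φ : OpenPartialHomeomorph M F) {x : M} (hx : x ∈ φ.source)
    (h1 : MDifferentiableAt I 𝓘(ℝ, F) φ x) (h2 : MDifferentiableAt 𝓘(ℝ, F) I φ.symm (φ x)) :
    Function.Injective (mvfderiv I φ x : E →L[ℝ] F) := by
  have h3 := mfderiv_comp (I := I) (I' := 𝓘(ℝ, F)) (I'' := I) x h2 h1
  have h4 : φ.symm ∘ φ =ᶠ[nhds x] id := by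
    filter_upwards [φ.open_source.mem_nhds hx] with y hy using φ.left_inv hy
  rw [h4.mfderiv_eq, mfderiv_id] at h3
  intro v w hvw
  have h5 := fun v : E ↦ congrArg (fun L : E →L[ℝ] E ↦ L v) h3
  exact (h5 v).trans ((congrArg (mfderiv 𝓘(ℝ, F) I φ.symm (φ x) : F →L[ℝ] E) hvw).trans (h5 w).symm)

/-- The vector field on a product with given components, each constant along the other factor. -/
def prodField (X : Π x : M, TangentSpace I x) (X' : Π y : M', TangentSpace I' y) (z : M × M') :
    TangentSpace (I.prod I') z :=
  ((X z.1 : E), (X' z.2 : E'))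

variable {X Y Z : Π x : M, TangentSpace I x} {X' Y' Z' : Π y : M', TangentSpace I' y}
  {z : M × M'}

section

variable [IsManifold I 1 M] [IsManifold I' 1 M']

theorem mdifferentiableAt_prodField (hX : MDiffAt (T% X) z.1) (hX' : MDiffAt (T% X') z.2) :
    MDiffAt (T% (prodField X X')) z := by
  have hS := (contMDiff_equivTangentBundleProd_symm (I := I) (I' := I') (M := M) (M' := M')
    (n := 1)).mdifferentiable one_ne_zero
  exact (hS (TotalSpace.mk' E z.1 (X z.1), TotalSpace.mk' E' z.2 (X' z.2))).comp z
    ((MDifferentiableAt.comp z hX mdifferentiableAt_fst).prodMk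
      (MDifferentiableAt.comp z hX' mdifferentiableAt_snd))

theorem contMDiffAt_prodField [IsManifold I (2 + 1) M] [IsManifold I' (2 + 1) M']
    (hX : ContMDiffAt I I.tangent 2 (T% X) z.1)
    (hX' : ContMDiffAt I' I'.tangent 2 (T% X') z.2) :
    ContMDiffAt (I.prod I') (I.prod I').tangent 2 (T% (prodField X X')) z := by
  have hS := contMDiff_equivTangentBundleProd_symm (I := I) (I' := I') (M := M) (M' := M') (n := 2)
  exact (hS (TotalSpace.mk' E z.1 (X z.1), TotalSpace.mk' E' z.2 (X' z.2))).comp z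
    ((ContMDiffAt.comp z hX contMDiffAt_fst).prodMk (ContMDiffAt.comp z hX' contMDiffAt_snd))

/-- Both projections relate a product field to its components, and brackets of related fields are
related. -/
theorem mlieBracket_prodField [I.Boundaryless] [I'.Boundaryless] [IsManifold I 2 M]
    [IsManifold I' 2 M'] [CompleteSpace E] [CompleteSpace E'] (hX : MDiffAt (T% X) z.1)
    (hX' : MDiffAt (T% X') z.2) (hY : MDiffAt (T% Y) z.1) (hY' : MDiffAt (T% Y') z.2) :
    VectorField.mlieBracket (I.prod I') (prodField X X') (prodField Y Y') z =
      prodField (VectorField.mlieBracket I X Y) (VectorField.mlieBracket I' X' Y') z := by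
  have hXX := mdifferentiableAt_prodField hX hX'
  have hYY := mdifferentiableAt_prodField hY hY'
  have h1 := mfderiv_mlieBracket (I := I.prod I') (I' := I) (f := Prod.fst) contMDiffAt_fst hXX hYY
    hX hY (Filter.Eventually.of_forall fun y ↦ by rw [mfderiv_fst]; rfl)
    (Filter.Eventually.of_forall fun y ↦ by rw [mfderiv_fst]; rfl)
  have h2 := mfderiv_mlieBracket (I := I.prod I') (I' := I') (f := Prod.snd) contMDiffAt_snd hXX hYY
    hX' hY' (Filter.Eventually.of_forall fun y ↦ by rw [mfderiv_snd]; rfl)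
    (Filter.Eventually.of_forall fun y ↦ by rw [mfderiv_snd]; rfl)
  rw [mfderiv_fst] at h1
  rw [mfderiv_snd] at h2
  exact Prod.ext h1 h2

end

namespace LinearConnection

theorem apply_zero [IsManifold I 1 M] (cov : LinearConnection I M)
    (Z : Π x : M, TangentSpace I x) :
    (fun y ↦ cov Z y ((0 : Π x : M, TangentSpace I x) y)) = 0 := by
  funext y; exact map_zero _

theorem zero_apply [IsManifold I 1 M] (cov : LinearConnection I M)
    (X : Π x : M, TangentSpace I x) :
    (fun y ↦ cov (0 : Π x : M, TangentSpace I x) y (X y)) = 0 := by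
  rw [CovariantDerivative.zero]; rfl

theorem curvatureField_zero_left [IsManifold I 1 M] (cov : LinearConnection I M)
    (Y Z : Π x : M, TangentSpace I x) : cov.curvatureField 0 Y Z = 0 := by
  funext x
  rw [curvatureField, apply_zero, VectorField.mlieBracket_zero_left, CovariantDerivative.zero]
  simp

theorem curvatureField_zero_middle [IsManifold I 1 M] (cov : LinearConnection I M)
    (X Z : Π x : M, TangentSpace I x) : cov.curvatureField X 0 Z = 0 := by
  funext x
  rw [curvatureField, apply_zero, VectorField.mlieBracket_zero_right, CovariantDerivative.zero]
  simp

variable [IsManifold I 1 M] [IsManifold I' 1 M'] (cov : LinearConnection I M)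
  (cov' : LinearConnection I' M')

/-- The mixed terms of the product connection differentiate a component along the other factor,
where it is constant. -/
theorem prod_prodField (v : TangentSpace (I.prod I') z) :
    cov.prod cov' (prodField X X') z v =
      ((cov X z.1 v.1 : E), (cov' X' z.2 v.2 : E')) := by
  let b : E := X z.1
  let b' : E' := X' z.2
  have h1 : (mvfderiv I' (fun _ : M' ↦ b) z.2 : E' →L[ℝ] E) v.2 = 0 := by
    rw [mvfderiv_const]; rfl
  have h2 : (mvfderiv I (fun _ : M ↦ b') z.1 : E →L[ℝ] E') v.1 = 0 := by
    rw [mvfderiv_const]; rfl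
  let a : E := cov X z.1 v.1
  let a' : E' := cov' X' z.2 v.2
  exact Prod.ext ((congrArg (a + ·) h1).trans (add_zero a))
    ((congrArg (· + a') h2).trans (zero_add a'))

theorem prod_prodField_prodField :
    (fun z ↦ cov.prod cov' (prodField Z Z') z (prodField X X' z)) =
      prodField (fun x ↦ cov Z x (X x)) (fun y ↦ cov' Z' y (X' y)) := by
  funext z
  exact prod_prodField cov cov' _

theorem mdifferentiableAt_prod_prodField (h : MDiffAt (T% fun x ↦ cov Z x (X x)) z.1)
    (h' : MDiffAt (T% fun y ↦ cov' Z' y (X' y)) z.2) :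
    MDiffAt (T% fun z ↦ cov.prod cov' (prodField Z Z') z (prodField X X' z)) z := by
  have h1 := mdifferentiableAt_prodField h h'
  rwa [← prod_prodField_prodField] at h1

theorem curvatureField_prodField [I.Boundaryless] [I'.Boundaryless] [IsManifold I 2 M]
    [IsManifold I' 2 M'] [CompleteSpace E] [CompleteSpace E'] (hX : MDiffAt (T% X) z.1)
    (hX' : MDiffAt (T% X') z.2) (hY : MDiffAt (T% Y) z.1) (hY' : MDiffAt (T% Y') z.2) :
    (cov.prod cov').curvatureField (prodField X X') (prodField Y Y') (prodField Z Z') z =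
      prodField (cov.curvatureField X Y Z) (cov'.curvatureField X' Y' Z') z := by
  rw [curvatureField, prod_prodField_prodField, prod_prodField_prodField,
    mlieBracket_prodField hX hX' hY hY', prod_prodField, prod_prodField, prod_prodField]
  rfl

/-- If a product connection is projectively flat and the first factor has positive dimension, then
the second factor has vanishing curvature. -/
theorem curvatureField_eq_zero_of_isProjectivelyFlat_prod [I.Boundaryless] [I'.Boundaryless]
    [IsManifold I ∞ M] [IsManifold I' ∞ M'] [FiniteDimensional ℝ E] [FiniteDimensional ℝ E']
    [Nontrivial E] (h : (cov.prod cov').IsProjectivelyFlat) (x : M) {g : M'}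
    (hX' : MDiffAt (T% X') g) (hY' : MDiffAt (T% Y') g)
    (hZ' : ContMDiffAt I' I'.tangent 2 (T% Z') g)
    (hZX : MDiffAt (T% fun y ↦ cov' Z' y (X' y)) g)
    (hZY : MDiffAt (T% fun y ↦ cov' Z' y (Y' y)) g) :
    cov'.curvatureField X' Y' Z' g = 0 := by
  have : CompleteSpace E := FiniteDimensional.complete ℝ E
  have : CompleteSpace E' := FiniteDimensional.complete ℝ E'
  have : IsManifold I 2 M := IsManifold.of_le (n := ∞) ENat.LEInfty.out
  have : IsManifold I' 2 M' := IsManifold.of_le (n := ∞) ENat.LEInfty.out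
  have : IsManifold I (2 + 1) M := IsManifold.of_le (n := ∞) (by norm_num; exact ENat.LEInfty.out)
  have : IsManifold I' (2 + 1) M' := IsManifold.of_le (n := ∞) (by norm_num; exact ENat.LEInfty.out)
  obtain ⟨e, he⟩ := exists_ne (0 : E)
  obtain ⟨φ, hφx, hφ, hφ', p, hp, hcov⟩ := h (x, g)
  have hs := φ.open_source.mem_nhds hφx
  have hφ1 := hφ.contMDiffAt hs
  have hinj := mfderiv_injective_of_openPartialHomeomorph φ hφx (hφ1.mdifferentiableAt (by simp))
    ((hφ'.contMDiffAt (φ.open_target.mem_nhds (φ.map_source hφx))).mdifferentiableAt (by simp))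
  -- The projectively flat curvature identity for product fields at (x, g), with the derivative of φ
  -- removed by injectivity. The rest of the proof evaluates it on three choices of fields.
  have hR : ∀ {X Y Z : Π x : M, TangentSpace I x} {X' Y' Z' : Π y : M', TangentSpace I' y},
      MDiffAt (T% X) x → MDiffAt (T% Y) x → MDiffAt (T% X') g → MDiffAt (T% Y') g →
      ContMDiffAt I I.tangent 2 (T% Z) x → ContMDiffAt I' I'.tangent 2 (T% Z') g →
      MDiffAt (T% fun y ↦ cov Z y (X y)) x → MDiffAt (T% fun y ↦ cov Z y (Y y)) x →
      MDiffAt (T% fun y ↦ cov' Z' y (X' y)) g → MDiffAt (T% fun y ↦ cov' Z' y (Y' y)) g →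
      ((cov.curvatureField X Y Z x, cov'.curvatureField X' Y' Z' g) : E × E') =
        extDer p (prodField X X') (prodField Y Y') (x, g) • ((Z x, Z' g) : E × E') +
        schouten (cov.prod cov') p (prodField X X') (prodField Z Z') (x, g) •
          ((Y x, Y' g) : E × E') -
        schouten (cov.prod cov') p (prodField Y Y') (prodField Z Z') (x, g) •
          ((X x, X' g) : E × E') := by
    intro X Y Z X' Y' Z' hX hY hX' hY' hZ hZ' hZX hZY hZX' hZY'
    have h1 := mvfderiv_curvatureField (cov.prod cov') (hφ1.of_le ENat.LEInfty.out)
      (hp.mdifferentiableAt hs) (by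
        filter_upwards [hs] with y hy Y hY v using hcov Y y hy hY v)
      (mdifferentiableAt_prodField (z := (x, g)) hX hX') (mdifferentiableAt_prodField hY hY')
      (contMDiffAt_prodField hZ hZ')
      (mdifferentiableAt_prod_prodField cov cov' hZX hZX')
      (mdifferentiableAt_prod_prodField cov cov' hZY hZY')
    rw [curvatureField_prodField cov cov' hX hX' hY hY'] at h1
    refine hinj (h1.trans ?_)
    have h2 : ∀ (L : E × E' →L[ℝ] E × E') (a b c : ℝ) (u v w : E × E'),
        a • L u + b • L v - c • L w = L (a • u + b • v - c • w) := by
      intro L a b c u v w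
      simp only [map_add, map_sub, map_smul]
    exact h2 _ _ _ _ _ _ _
  let U : Π x : M, TangentSpace I x := FiberBundle.extend E (x := x) e
  have hU : ContMDiffAt I I.tangent 2 (T% U) x := FiberBundle.contMDiffAt_extend I E _
  have hUx : (U x : E) = e := FiberBundle.extend_apply_self (E := fun x : M ↦ TangentSpace I x) (x := x) E e
  let u : E := U x
  have hu : u ≠ 0 := fun h ↦ he (hUx.symm.trans h)
  have hU1 := hU.mdifferentiableAt two_ne_zero
  have h0 : ContMDiff I I.tangent 2 (T% (0 : Π x : M, TangentSpace I x)) :=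
    contMDiff_zeroSection ℝ (TangentSpace I : M → Type _)
  have h0' : ContMDiff I' I'.tangent 2 (T% (0 : Π x : M', TangentSpace I' x)) :=
    contMDiff_zeroSection ℝ (TangentSpace I' : M' → Type _)
  have h01 := (h0 x).mdifferentiableAt two_ne_zero
  have h01' := (h0' g).mdifferentiableAt two_ne_zero
  have hd1 : ∀ Z : Π x : M, TangentSpace I x,
      MDiffAt (T% fun y ↦ cov Z y ((0 : Π x : M, TangentSpace I x) y)) x :=
     fun Z ↦ (congrArg (fun W : Π x : M, TangentSpace I x ↦ MDiffAt (T% W) x)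
      (cov.apply_zero Z)).mpr h01
  have hd2 : ∀ X : Π x : M, TangentSpace I x,
      MDiffAt (T% fun y ↦ cov (0 : Π x : M, TangentSpace I x) y (X y)) x :=
     fun X ↦ (congrArg (fun W : Π x : M, TangentSpace I x ↦ MDiffAt (T% W) x)
      (cov.zero_apply X)).mpr h01
  have hd3 : MDiffAt (T% fun y ↦ cov' Z' y ((0 : Π x : M', TangentSpace I' x) y)) g :=
     (congrArg (fun W : Π x : M', TangentSpace I' x ↦ MDiffAt (T% W) g)
      (cov'.apply_zero Z')).mpr h01'
  have hd4 : ∀ X' : Π x : M', TangentSpace I' x,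
      MDiffAt (T% fun y ↦ cov' (0 : Π x : M', TangentSpace I' x) y (X' y)) g :=
     fun X' ↦ (congrArg (fun W : Π x : M', TangentSpace I' x ↦ MDiffAt (T% W) g)
      (cov'.zero_apply X')).mpr h01'
  have hlin1 : ∀ {a b c : ℝ}, (0 : E) = a • (0 : E) + b • (0 : E) - c • u → c = 0 := by
    intro a b c h
    simpa [hu] using h
  have hlin2 : ∀ {a b c : ℝ}, (0 : E) = a • u + b • (0 : E) - c • (0 : E) → a = 0 := by
    intro a b c h
    simpa [hu] using h.symm
  have hlin3 : ∀ {u v w r : E'}, r = (0 : ℝ) • u + (0 : ℝ) • v - (0 : ℝ) • w → r = 0 := by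
    intro u v w r h
    simpa using h
  -- Evaluate on (U, 0), (0, W'), (0, Z'). The first components leave only the multiple of u by this
  -- Schouten term, and the curvature on the left vanishes.
  have hS : ∀ {W' : Π y : M', TangentSpace I' y}, MDiffAt (T% W') g →
      MDiffAt (T% fun y ↦ cov' Z' y (W' y)) g →
      schouten (cov.prod cov') p (prodField (0 : Π x : M, TangentSpace I x) W')
        (prodField 0 Z') (x, g) = 0 := by
    intro W' hW' hZW
    have h1 := congrArg Prod.fst
      (hR hU1 h01 h01' hW' (h0 x) hZ' (hd2 U) (hd2 0) hd3 hZW)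
    rw [curvatureField_zero_middle] at h1
    exact hlin1 h1
  -- Evaluate on (0, X'), (0, Y'), (U, 0): now the first components leave only the multiple of u by
  -- the exterior derivative.
  have hE : extDer p (prodField (0 : Π x : M, TangentSpace I x) X') (prodField 0 Y') (x, g) = 0 := by
    have h1 := congrArg Prod.fst
      (hR h01 h01 hX' hY' hU (h0' g) (hd1 U) (hd1 U) (hd4 X') (hd4 Y'))
    rw [curvatureField_zero_left] at h1
    exact hlin2 h1
  -- With all three coefficients zero, the second component is the vanishing of the curvature of the
  -- second factor.
  have h1 := hR h01 h01 hX' hY' (h0 x) hZ' (hd2 0) (hd2 0) hZX hZY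
  rw [hE, hS hX' hZX, hS hY' hZY] at h1
  have h2 := congrArg Prod.snd h1
  exact hlin3 h2

end LinearConnection

end ProductConnection

end

/-! ### The three conclusions assembled. -/

theorem mainTheorem12 (m : ℕ) [NeZero m] (hm : 2 ≤ m)
    (cov' : LinearConnection 𝓘(ℝ, SLAlg m) (PL m))
    [CovariantDerivative.ContMDiffCovariantDerivative cov' ∞]
    (hcov' : (nablaPL m).IsProjectivelyEquivalent cov') :
    ¬ cov'.IsAffinelyFlat ∧
    (∃ (g : PL m) (v w : TangentSpace 𝓘(ℝ, SLAlg m) g), cov'.ricci g v w ≠ 0) ∧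
    ∀ (E : Type*) [NormedAddCommGroup E] [NormedSpace ℝ E] [FiniteDimensional ℝ E] [Nontrivial E]
      (M : Type*) [TopologicalSpace M] [T2Space M] [SecondCountableTopology M] [Nonempty M]
      [ChartedSpace E M] [IsManifold 𝓘(ℝ, E) ∞ M]
      (cov : LinearConnection 𝓘(ℝ, E) M)
      [CovariantDerivative.ContMDiffCovariantDerivative cov ∞],
      cov.IsAffinelyFlat → ¬ (cov.prod cov').IsProjectivelyFlat := by
  obtain ⟨g, v, w, h⟩ := PL.exists_ricci_ne_zero hm hcov'
  refine ⟨fun hflat ↦ h (PL.ricci_eq_zero_of_curvature_eq_zero hflat.2 g v w), ⟨g, v, w, h⟩, ?_⟩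
  intro E _ _ _ _ M _ _ _ _ _ _ cov _ _ hflat
  -- It suffices to kill the curvature of the second factor at each g. Left invariant fields realise
  -- all triples of tangent vectors, so the vanishing on them makes `leftCurvature` zero for all
  -- arguments.
  refine h (PL.ricci_eq_zero_of_curvature_eq_zero (fun g u v w ↦ ?_) g v w)
  obtain ⟨p, hp, hcov⟩ := hcov'
  have hp' := hp.mdifferentiableAt (x := g) Filter.univ_mem
  have hd := fun x ↦ mdifferentiableAt_leftTranslation (I := 𝓘(ℝ, SLAlg m)) x g
  have hc := fun x ↦ contMDiff_leftTranslation (I := 𝓘(ℝ, SLAlg m)) x g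
  have h1 := fun x y z ↦ LinearConnection.curvatureField_eq_zero_of_isProjectivelyFlat_prod
    cov cov' hflat (Classical.arbitrary M) (hd x) (hd y) (hc z)
    (mdifferentiableAt_cov hcov hp' (hd x) (hc z)) (mdifferentiableAt_cov hcov hp' (hd y) (hc z))
  have h2 := fun x y z ↦ maurerCartan_curvatureField hcov
    (fun x y ↦ (PL.leftBracket_eq x y).symm) hp' (hd x) (hd y) (hc z)
  simp only [h1, map_zero, maurerCartan_leftTranslation] at h2
  rw [curvature_eq_leftTranslation hcov (fun x y ↦ (PL.leftBracket_eq x y).symm) hp', ← h2,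
    map_zero]
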